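/- Let $(X,d_X)$ be a separable, locally compact metric space and $\mu$ a Borel regular measure on $X$ with $0<\mu(B(x,r))<\infty$ for every ball. Let $\mathcal M$ be the set of Borel measures $\nu\le\mu$ with compact support, $\mathcal X=\mathcal M\setminus\{0\}$ and $\|\nu\|=\nu(X)$. Fix a strictly increasing continuous $h:[0,\infty)\to[0,\infty)$ with $h(0)=\lim_{\varepsilon\to0^+}h(\varepsilon)/\varepsilon=0$, $h(a)+h(b)\le h(a+b)$ for $a,b\ge 0$, and $h(\varepsilon)\to\infty$ as $\varepsilon\to\infty$. For $\nu,\eta\in\mathcal M$ let $d_{\mathcal M}(\nu,\eta)$ be the infimum of the $\varepsilon>0$ for which there are at most countable families $\nu_i,\eta_i\in\mathcal M$ with $\nu=\sum_i\nu_i$, $\eta=\sum_i\eta_i$, $\sum_i\bigl|\|\nu_i\|-\|\eta_i\|\bigr|\le h(\varepsilon)$ and $\operatorname{diam}(\operatorname{supp}\nu_i\cup\operatorname{supp}\eta_i)\le\varepsilon$ for all $i$. A curve is a $1$-Lipschitz map $\nu:[0,b_\nu]\to(\mathcal X,d_{\mathcal M})$ with $b_\nu\ge 0$. For $f\in L^1_{\rm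 loc}(X)$ and $\eta\in\mathcal X$ put $F_f(\eta)=\|\eta\|^{-1}\int f\,d\eta$, and for $F:\mathcal X\to\mathbb R$ put $$r_F(\eta)=\lim_{\varepsilon\to0^+}\ \sup\Bigl\{\tfrac{|F(\nu(s))-F(\eta)|}{s}:\ \nu\text{ a curve},\ \nu(0)=\eta,\ 0<s<\min(\varepsilon,b_\nu)\Bigr\}\in[0,\infty].$$ We say that $f\in L^1_{\rm loc}(X)$ has the upper gradient $g_f=g\in L^1_{\rm loc}(X)$ if $r_{F_f}=F_g$ on $\mathcal X$. **Theorem.** Let $k\in L^1_{\rm loc}(X)$ have an upper gradient $g_k\in L^1_{\rm loc}(X)$ and let $c\in\mathbb R$. Then $k\wedge c=\min(k,c)$ and $k\vee c=\max(k,c)$ have upper gradients in $L^1_{\rm loc}(X)$; these are unique up to equality $\mu$-a.e., and $\mu$-a.e. $$g_{k\wedge c}=g_k\,\chi_{\{k<c\}},\qquad g_{k\vee c}=g_k\,\chi_{\{k>c\}}.$$ The same conclusion (existence, uniqueness and both formulas) holds if, throughout, $g_f$ is instead understood as the $\mu$-a.e. smallest $\mu$-a.e. nonnegative $g\in L^1_{\rm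 loc}(X)$ with $$\Bigl|\int f\,d\nu(s)-\int f\,d\nu(0)\Bigr|\le\int_0^s\Bigl(\int g\,d\nu(t)\Bigr)dt\qquad\text{for every curve }\nu\text{ and every }s\in[0,b_\nu].$$ -/

import Mathlib

open MeasureTheory Set Filter Topology
open scoped ENNReal

namespace MeasureCurves

/-- The gauge functions `h` on `[0, ∞)` used to price a change of total mass. -/
structure IsGauge (h : ℝ → ℝ) : Prop where
  strictMonoOn : StrictMonoOn h (Ici 0)
  continuousOn : ContinuousOn h (Ici 0)
  zero : h 0 = 0
  tendsto_div : Tendsto (fun ε => h ε / ε) (𝓝[>] 0) (𝓝 0)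
  superadditive : ∀ a b : ℝ, 0 ≤ a → 0 ≤ b → h a + h b ≤ h (a + b)
  tendsto_atTop : Tendsto h atTop atTop

section Space

variable {X : Type*} [MetricSpace X] [MeasurableSpace X]

/-- `𝓜`: the Borel measures with compact support that are dominated by `μ`. -/
def DomMeasures (μ : Measure X) : Set (Measure X) :=
  {ν | ν ≤ μ ∧ IsCompact ν.support}

/-- `𝓧 = 𝓜 \ {0}`. -/
abbrev NonzeroDom (μ : Measure X) : Type _ :=
  {ν : Measure X // ν ∈ DomMeasures μ ∧ ν ≠ 0}

/-- `(νs i, ηs i)` belongs to `Γ_{ε,δ}(ν, η)`. Finite families are padded by zero measures. -/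
structure IsDecomposition (μ : Measure X) (ε δ : ℝ) (ν η : Measure X)
    (νs ηs : ℕ → Measure X) : Prop where
  left_mem : ∀ i, νs i ∈ DomMeasures μ
  right_mem : ∀ i, ηs i ∈ DomMeasures μ
  left_sum : ν = Measure.sum νs
  right_sum : η = Measure.sum ηs
  mass_le : ∑' i, ENNReal.ofReal |(νs i).real univ - (ηs i).real univ| ≤ ENNReal.ofReal δ
  diam_le : ∀ i, Metric.diam ((νs i).support ∪ (ηs i).support) ≤ ε

/-- The distance `d_𝓜(ν, η) = inf {ε > 0 : Γ_{ε,h(ε)}(ν, η) ≠ ∅}` on `𝓜`. -/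
noncomputable def domDist (μ : Measure X) (h : ℝ → ℝ) (ν η : Measure X) : ℝ :=
  sInf {ε : ℝ | 0 < ε ∧ ∃ νs ηs : ℕ → Measure X, IsDecomposition μ ε (h ε) ν η νs ηs}

/-- The restriction of `ν` to `[0, b]` is a `1`-Lipschitz curve in `(𝓧, d_𝓜)`, that is, a rectifiable
curve subparametrized by arc length. Values of `ν` outside `[0, b]` play no role. -/
structure IsCurve (μ : Measure X) (h : ℝ → ℝ) (b : ℝ) (ν : ℝ → NonzeroDom μ) : Prop where
  nonneg : 0 ≤ b
  lipschitz : ∀ s t : ℝ, 0 ≤ s → s ≤ t → t ≤ b → domDist μ h (ν t).1 (ν s).1 ≤ t - s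

/-- The mean value function `F_f(η) = ‖η‖⁻¹ ∫ f dη` on `𝓧`. -/
noncomputable def meanValue (μ : Measure X) (f : X → ℝ) (η : NonzeroDom μ) : ℝ :=
  (η.1.real univ)⁻¹ * ∫ x, f x ∂η.1

/-- `r_F^ε(η)`: the supremum of `|F(ν(s)) - F(η)| / s` over all curves `ν : [0, b] → 𝓧` with
`ν(0) = η` and all `0 < s < min ε b`. -/
noncomputable def curveSlopeAt (μ : Measure X) (h : ℝ → ℝ) (F : NonzeroDom μ → ℝ) (ε : ℝ)
    (η : NonzeroDom μ) : ℝ≥0∞ :=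
  ⨆ (b : ℝ) (ν : ℝ → NonzeroDom μ) (_ : IsCurve μ h b ν) (_ : ν 0 = η)
    (s : ℝ) (_ : 0 < s ∧ s < min ε b), ENNReal.ofReal (|F (ν s) - F η| / s)

/-- `r_F(η) = lim_{ε → 0+} r_F^ε(η)`; as `r_F^ε` is nondecreasing in `ε`, the limit is the infimum
over `ε > 0`. -/
noncomputable def curveSlope (μ : Measure X) (h : ℝ → ℝ) (F : NonzeroDom μ → ℝ)
    (η : NonzeroDom μ) : ℝ≥0∞ :=
  ⨅ (ε : ℝ) (_ : 0 < ε), curveSlopeAt μ h F ε η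

/-- `g` is (a representative of) the upper gradient `g_f`: both functions are locally integrable and
`r_{F_f} = F_g` on `𝓧`. -/
structure IsUpperGradient (μ : Measure X) (h : ℝ → ℝ) (f g : X → ℝ) : Prop where
  locallyIntegrable : LocallyIntegrable f μ
  locallyIntegrable_grad : LocallyIntegrable g μ
  slope_eq : ∀ η : NonzeroDom μ,
    ((curveSlope μ h (meanValue μ f) η : ℝ≥0∞) : EReal) = ((meanValue μ g η : ℝ) : EReal)

/-- The nonnegative locally integrable `g` bounds the variation of `f` along every curve:
`|∫ f dν(s) - ∫ f dν(0)| ≤ ∫_0^s (∫ g dν(t)) dt`. -/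
structure BoundsAlongCurves (μ : Measure X) (h : ℝ → ℝ) (f g : X → ℝ) : Prop where
  locallyIntegrable : LocallyIntegrable f μ
  locallyIntegrable_grad : LocallyIntegrable g μ
  nonneg : 0 ≤ᵐ[μ] g
  bound : ∀ (b : ℝ) (ν : ℝ → NonzeroDom μ), IsCurve μ h b ν → ∀ s : ℝ, 0 ≤ s → s ≤ b →
    |(∫ x, f x ∂(ν s).1) - ∫ x, f x ∂(ν 0).1| ≤ ∫ t in (0 : ℝ)..s, ∫ x, g x ∂(ν t).1

/-- `g` is the `μ`-a.e. smallest function that bounds the variation of `f` along curves. -/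
structure IsSmallestBound (μ : Measure X) (h : ℝ → ℝ) (f g : X → ℝ) : Prop where
  bounds : BoundsAlongCurves μ h f g
  le : ∀ g' : X → ℝ, BoundsAlongCurves μ h f g' → g ≤ᵐ[μ] g'

end Space

end MeasureCurves

/-!
Along a curve the total mass is constant, because `h ε = o(ε)`: subdividing `[s, t]` into `n` steps
bounds the change of mass by `n h((t - s) / n) → 0`. The same subdivision, with the couplings of
consecutive steps glued together, turns the bound `d_𝓜(ν s, ν t) ≤ t - s` into a bound on the
`∞`-Wasserstein distance. Since couplings restrict to parts of a measure, weak compactness then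
gives, for each part `a₀ ≤ ν 0`, a curve `a ≤ ν` that starts at `a₀`.

Following the part of `ν 0` on `{k < c}` and replacing `k` by `c` on the rest, one gets
`∫ min(k, c) dν(s) ≤ ∫ min(k, c) dν(0) + ∫_0^s ∫ g da(t) dt`, so that `min(k, c)` grows at most at
the rate `∫ g χ_{k<c} dη`; reversing curves bounds the decrease, and `max(k, c)` is the case of `-k`
and `-c`. Because `min(k, c) + max(k, c) = k + c`, slopes are subadditive and the two bounds add up
to at most the slope of `k`, both are equalities. A locally integrable function is determined a.e.
by its integrals against `𝓧`, whence uniqueness.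

The slope condition implies the integral inequality by a Dini derivative argument; conversely the
rate of change at time `0` is recovered from the continuity of `t ↦ ∫ g dν(t)`.
-/

namespace MeasureCurves

open ProbabilityTheory

/-! ### Locally compact separable spaces are Polish -/

theorem isOpen_range_of_isDenseInducing {α β : Type*} [TopologicalSpace α] [TopologicalSpace β]
    [WeaklyLocallyCompactSpace α] [T2Space β] {f : α → β} (hf : IsDenseInducing f) :
    IsOpen (range f) := by
  rw [isOpen_iff_mem_nhds]
  rintro _ ⟨x, rfl⟩
  obtain ⟨K, hK, hxK⟩ := exists_compact_mem_nhds x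
  have hclosed : IsClosed (f '' K) := (hK.image hf.continuous).isClosed
  have hmem : closure (f '' K) ∈ 𝓝 (f x) := hf.closure_image_mem_nhds hxK
  exact mem_of_superset (hclosed.closure_eq ▸ hmem) (image_subset_range f K)

theorem polishSpace_of_locallyCompact (X : Type*) [MetricSpace X] [LocallyCompactSpace X]
    [TopologicalSpace.SeparableSpace X] : PolishSpace X := by
  have : SecondCountableTopology (UniformSpace.Completion X) :=
    UniformSpace.secondCountable_of_separable _
  have hopen : IsOpenEmbedding ((↑) : X → UniformSpace.Completion X) :=
    ⟨UniformSpace.Completion.coe_isometry.isEmbedding,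
      isOpen_range_of_isDenseInducing UniformSpace.Completion.isDenseInducing_coe⟩
  have : PolishSpace (range ((↑) : X → UniformSpace.Completion X)) := hopen.isOpen_range.polishSpace
  exact hopen.isEmbedding.toHomeomorph.isClosedEmbedding.polishSpace

/-! ### Couplings -/

section Couplings

theorem exists_gluing {α β γ : Type*} [MeasurableSpace α] [MeasurableSpace β] [MeasurableSpace γ]
    [StandardBorelSpace γ] {p : Measure (α × β)} {q : Measure (β × γ)} [SFinite p]
    [IsFiniteMeasure q] (hpq : p.snd = q.fst) :
    ∃ r : Measure ((α × β) × γ), r.fst = p ∧ r.map (Prod.map Prod.snd id) = q := by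
  rcases isEmpty_or_nonempty γ with hγ | hγ
  · have hp : p.snd = 0 := by rw [hpq, Measure.eq_zero_of_isEmpty q, Measure.fst_zero]
    rw [Measure.snd, Measure.map_eq_zero_iff measurable_snd.aemeasurable] at hp
    exact ⟨0, by rw [hp, Measure.fst_zero], by rw [Measure.map_zero, Measure.eq_zero_of_isEmpty q]⟩
  refine ⟨p ⊗ₘ Kernel.prodMkLeft α q.condKernel, Measure.fst_compProd p _, ?_⟩
  have hm : Measurable (Prod.map Prod.snd id : (α × β) × γ → β × γ) :=
    measurable_snd.prodMap measurable_id
  ext s hs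
  rw [Measure.map_apply hm hs, Measure.compProd_apply (hm hs)]
  conv_rhs => rw [← q.disintegrate q.condKernel, Measure.compProd_apply hs, ← hpq, Measure.snd,
    lintegral_map (Kernel.measurable_kernel_prodMk_left hs) measurable_snd]
  rfl

theorem exists_le_fst_eq_of_le {α β : Type*} [MeasurableSpace α] [MeasurableSpace β]
    [StandardBorelSpace β] {p : Measure (α × β)} [IsFiniteMeasure p] {a : Measure α}
    (ha : a ≤ p.fst) : ∃ q ≤ p, q.fst = a := by
  have : IsFiniteMeasure a := isFiniteMeasure_of_le _ ha
  rcases isEmpty_or_nonempty β with hβ | hβ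
  · rw [Measure.eq_zero_of_isEmpty p, Measure.fst_zero] at ha
    exact ⟨0, Measure.zero_le _, by rw [Measure.fst_zero, le_antisymm ha (Measure.zero_le _)]⟩
  refine ⟨a ⊗ₘ p.condKernel, ?_, Measure.fst_compProd _ _⟩
  conv_rhs => rw [← p.disintegrate p.condKernel]
  refine Measure.le_iff.2 fun s hs => ?_
  rw [Measure.compProd_apply hs, Measure.compProd_apply hs]
  exact lintegral_mono' ha le_rfl

theorem isFiniteMeasure_of_fst {α β : Type*} [MeasurableSpace α] [MeasurableSpace β]
    {p : Measure (α × β)} [IsFiniteMeasure p.fst] : IsFiniteMeasure p :=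
  (Measure.isFiniteMeasure_map_iff measurable_fst.aemeasurable).1 ‹_›

variable {X : Type*} [PseudoMetricSpace X] [MeasurableSpace X] {δ δ' : ℝ} {κ κ' : ℝ≥0∞}
  {a b c : Measure X}

/-- `a` and `b` are the marginals of a measure on `X × X` that gives mass at most `κ` to the pairs
of points at distance greater than `δ`. -/
def NearlyCoupled (δ : ℝ) (κ : ℝ≥0∞) (a b : Measure X) : Prop :=
  ∃ p : Measure (X × X), p.fst = a ∧ p.snd = b ∧ p {z | δ < dist z.1 z.2} ≤ κ

/-- The `∞`-Wasserstein distance of `a` and `b` is at most `δ`: they can be coupled within every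
distance `δ' > δ`. -/
def Close (δ : ℝ) (a b : Measure X) : Prop :=
  ∀ δ', δ < δ' → NearlyCoupled δ' 0 a b

theorem NearlyCoupled.mono (hab : NearlyCoupled δ κ a b) (hδ : δ ≤ δ') (hκ : κ ≤ κ') :
    NearlyCoupled δ' κ' a b := by
  obtain ⟨p, hp, hp', h⟩ := hab
  exact ⟨p, hp, hp', (measure_mono fun z hz => lt_of_le_of_lt hδ hz).trans (h.trans hκ)⟩

theorem Close.mono (hab : Close δ a b) (hδ : δ ≤ δ') : Close δ' a b :=
  fun _ h => hab _ (hδ.trans_lt h)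

theorem NearlyCoupled.univ_eq (hab : NearlyCoupled δ κ a b) : a univ = b univ := by
  obtain ⟨p, rfl, rfl, -⟩ := hab
  rw [Measure.fst_univ, Measure.snd_univ]

theorem Close.univ_eq (hab : Close δ a b) : a univ = b univ :=
  (hab (δ + 1) (by linarith)).univ_eq

theorem NearlyCoupled.split [StandardBorelSpace X] {a' : Measure X} [IsFiniteMeasure a]
    (hab : NearlyCoupled δ κ a b) (ha' : a' ≤ a) : ∃ b' ≤ b, NearlyCoupled δ κ a' b' := by
  obtain ⟨p, rfl, rfl, h⟩ := hab
  have : IsFiniteMeasure p := isFiniteMeasure_of_fst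
  obtain ⟨q, hqp, hq⟩ := exists_le_fst_eq_of_le ha'
  exact ⟨q.snd, Measure.map_mono hqp measurable_snd, q, hq, rfl, (hqp _).trans h⟩

variable [OpensMeasurableSpace X] [SecondCountableTopology X]

theorem measurableSet_lt_dist (δ : ℝ) : MeasurableSet {z : X × X | δ < dist z.1 z.2} :=
  measurableSet_lt measurable_const (measurable_fst.dist measurable_snd)

theorem NearlyCoupled.symm (hab : NearlyCoupled δ κ a b) : NearlyCoupled δ κ b a := by
  obtain ⟨p, rfl, rfl, h⟩ := hab
  refine ⟨p.map Prod.swap, Measure.fst_map_swap, Measure.snd_map_swap, ?_⟩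
  rw [Measure.map_apply measurable_swap (measurableSet_lt_dist δ)]
  simpa only [preimage_ofPred_eq, Prod.fst_swap, Prod.snd_swap, dist_comm] using h

theorem Close.symm (hab : Close δ a b) : Close δ b a :=
  fun δ' h => (hab δ' h).symm

theorem NearlyCoupled.refl (hδ : 0 ≤ δ) (a : Measure X) : NearlyCoupled δ 0 a a := by
  have hd : Measurable fun x : X => (x, x) := measurable_id.prodMk measurable_id
  refine ⟨a.map fun x => (x, x), ?_, ?_, ?_⟩
  · rw [Measure.fst, Measure.map_map measurable_fst hd]
    exact Measure.map_id
  · rw [Measure.snd, Measure.map_map measurable_snd hd]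
    exact Measure.map_id
  · rw [Measure.map_apply hd (measurableSet_lt_dist δ)]
    simp [hδ.not_gt]

theorem Close.refl (hδ : 0 ≤ δ) (a : Measure X) : Close δ a a :=
  fun _ hδ' => NearlyCoupled.refl (hδ.trans hδ'.le) a

theorem NearlyCoupled.trans [StandardBorelSpace X] [IsFiniteMeasure a]
    (hab : NearlyCoupled δ κ a b) (hbc : NearlyCoupled δ' κ' b c) :
    NearlyCoupled (δ + δ') (κ + κ') a c := by
  have : IsFiniteMeasure b := ⟨hab.univ_eq ▸ measure_lt_top a univ⟩
  obtain ⟨p, rfl, hpb, hp⟩ := hab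
  obtain ⟨q, rfl, rfl, hq⟩ := hbc
  have : IsFiniteMeasure p := isFiniteMeasure_of_fst
  have : IsFiniteMeasure q := isFiniteMeasure_of_fst
  obtain ⟨r, rfl, rfl⟩ := exists_gluing hpb
  have hm : Measurable (Prod.map Prod.fst id : (X × X) × X → X × X) := by fun_prop
  have hm' : Measurable (Prod.map Prod.snd id : (X × X) × X → X × X) := by fun_prop
  rw [Measure.fst_apply (measurableSet_lt_dist δ)] at hp
  rw [Measure.map_apply hm' (measurableSet_lt_dist δ')] at hq
  refine ⟨r.map (Prod.map Prod.fst id), ?_, ?_, ?_⟩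
  · simp only [Measure.fst, Measure.map_map measurable_fst hm,
      Measure.map_map measurable_fst measurable_fst]
    rfl
  · simp only [Measure.snd, Measure.map_map measurable_snd hm, Measure.map_map measurable_snd hm']
    rfl
  · rw [Measure.map_apply hm (measurableSet_lt_dist _)]
    refine (measure_mono fun w hw => ?_).trans ((measure_union_le _ _).trans (add_le_add hp hq))
    by_contra hcon
    simp only [mem_union, mem_preimage, mem_ofPred_eq, not_or, not_lt, Prod.map_fst, Prod.map_snd,
      id_eq] at hcon hw
    linarith [dist_triangle w.1.1 w.1.2 w.2]

theorem nearlyCoupled_of_forall_succ [StandardBorelSpace X] {a : ℕ → Measure X}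
    [∀ i, IsFiniteMeasure (a i)] {n : ℕ} (ha : ∀ i < n, NearlyCoupled δ κ (a i) (a (i + 1))) :
    NearlyCoupled (n * δ) (n * κ) (a 0) (a n) := by
  induction n with
  | zero => simpa using NearlyCoupled.refl le_rfl (a 0)
  | succ n ih =>
    have hstep := (ih fun i hi => ha i (hi.trans n.lt_succ_self)).trans (ha n n.lt_succ_self)
    exact hstep.mono (by push_cast; linarith) (by push_cast; rw [add_one_mul])

theorem Close.trans [StandardBorelSpace X] [IsFiniteMeasure a] (hab : Close δ a b)
    (hbc : Close δ' b c) : Close (δ + δ') a c := by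
  intro d hd
  have := (hab (δ + (d - (δ + δ')) / 2) (by linarith)).trans
    (hbc (δ' + (d - (δ + δ')) / 2) (by linarith))
  exact this.mono (by linarith) (add_zero _).le

end Couplings

/-! ### Weak limits -/

section WeakLimits

open scoped NNReal BoundedContinuousFunction

theorem measure_compl_eq_zero_of_le {X : Type*} [TopologicalSpace X] [HereditarilyLindelofSpace X]
    [MeasurableSpace X] {a ν : Measure X} {K : Set X} (ha : a ≤ ν)
    (hK : ν.support ⊆ K) : a Kᶜ = 0 :=
  nonpos_iff_eq_zero.1 <| (ha _).trans
    (measure_mono_null (compl_subset_compl.2 hK) Measure.measure_compl_support).le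

theorem measure_isOpen_le_of_tendsto {Ω ι : Type*} [TopologicalSpace Ω] [NormalSpace Ω]
    [MeasurableSpace Ω] [OpensMeasurableSpace Ω] {l : Filter ι} [l.NeBot]
    {ms : ι → FiniteMeasure Ω} {m : FiniteMeasure Ω} [(m : Measure Ω).WeaklyRegular]
    (hm : Tendsto ms l (𝓝 m)) {c : ι → ℝ≥0∞} {c₀ : ℝ≥0∞} (hc : Tendsto c l (𝓝 c₀)) {G : Set Ω}
    (hG : IsOpen G) (hle : ∀ᶠ i in l, (ms i : Measure Ω) G ≤ c i) : (m : Measure Ω) G ≤ c₀ := by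
  rw [hG.measure_eq_iSup_isClosed]
  refine iSup₂_le fun F hFG => iSup_le fun hF => ?_
  obtain ⟨f, hf0, hf1, hf⟩ := exists_bounded_zero_one_of_closed hG.isClosed_compl hF
    (disjoint_compl_left_iff_subset.2 hFG)
  let g : Ω →ᵇ ℝ≥0 := f.nnrealPart
  have hFg : F.indicator 1 ≤ fun x => (g x : ℝ≥0∞) := by
    refine indicator_le fun x hx => ?_
    simp [g, hf1 hx]
  have hgG : (fun x => (g x : ℝ≥0∞)) ≤ G.indicator 1 := by
    intro x
    by_cases hx : x ∈ G
    · simpa [g, hx] using (hf x).2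
    · simp [g, hx, hf0 (mem_compl hx)]
  calc (m : Measure Ω) F
    _ = ∫⁻ x, F.indicator 1 x ∂m := (lintegral_indicator_one hF.measurableSet).symm
    _ ≤ ∫⁻ x, g x ∂m := lintegral_mono hFg
    _ ≤ c₀ := by
      refine le_of_tendsto_of_tendsto
        (FiniteMeasure.tendsto_iff_forall_lintegral_tendsto.1 hm g) hc ?_
      filter_upwards [hle] with i hi
      exact (lintegral_mono hgG).trans ((lintegral_indicator_one hG.measurableSet).trans_le hi)

theorem isClosed_setOf_toMeasure_le {Ω : Type*} [TopologicalSpace Ω]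
    [TopologicalSpace.PseudoMetrizableSpace Ω] [MeasurableSpace Ω] [BorelSpace Ω] (A : Measure Ω)
    [A.OuterRegular] : IsClosed {m : FiniteMeasure Ω | (m : Measure Ω) ≤ A} := by
  let := TopologicalSpace.pseudoMetrizableSpacePseudoMetric Ω
  refine isClosed_iff_ultrafilter.2 fun m U hU hUA => Measure.le_intro fun s _ _ => ?_
  rw [s.measure_eq_iInf_isOpen A]
  refine le_iInf₂ fun G hsG => le_iInf fun hG => (measure_mono hsG).trans ?_
  exact measure_isOpen_le_of_tendsto (ms := id) hU tendsto_const_nhds hG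
    (mem_of_superset hUA fun m hm => hm G)

theorem isCompact_setOf_toMeasure_le {Ω : Type*} [TopologicalSpace Ω]
    [TopologicalSpace.MetrizableSpace Ω] [MeasurableSpace Ω] [BorelSpace Ω] {A : Measure Ω}
    [IsFiniteMeasure A] {K : Set Ω} (hK : IsCompact K) (hA : A Kᶜ = 0) :
    IsCompact {m : FiniteMeasure Ω | (m : Measure Ω) ≤ A} := by
  let := TopologicalSpace.metrizableSpaceMetric Ω
  refine (isCompact_setOfPred_finiteMeasure_le_of_isCompact (A univ).toNNReal hK).of_isClosed_subset
    (isClosed_setOf_toMeasure_le A) fun m hm => ⟨?_, ?_⟩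
  · exact ENNReal.toNNReal_mono (measure_ne_top A univ) (hm univ)
  · exact (m.null_iff_toMeasure_null _).2 (nonpos_iff_eq_zero.1 ((hm _).trans hA.le))

variable {X : Type*} [MetricSpace X] [MeasurableSpace X] [BorelSpace X] [SecondCountableTopology X]

theorem measure_compl_prod_eq_zero {α β : Type*} [MeasurableSpace α] [MeasurableSpace β]
    {p : Measure (α × β)} {K : Set α} {L : Set β} (hK : MeasurableSet K) (hL : MeasurableSet L)
    (hpK : p.fst Kᶜ = 0) (hpL : p.snd Lᶜ = 0) : p (K ×ˢ L)ᶜ = 0 := by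
  rw [compl_prod_eq_union]
  rw [Measure.fst_apply hK.compl] at hpK
  rw [Measure.snd_apply hL.compl] at hpL
  exact measure_union_null (by simpa [prod_univ] using hpK) (by simpa [univ_prod] using hpL)

theorem exists_tendsto_of_tendsto_map {ι : Type*} {U : Ultrafilter ι} {K L : Set X}
    (hK : IsCompact K) (hL : IsCompact L) {p : ι → FiniteMeasure (X × X)} {a b : FiniteMeasure X}
    (hpK : ∀ᶠ i in U, (p i).map Prod.fst Kᶜ = 0) (hpL : ∀ᶠ i in U, (p i).map Prod.snd Lᶜ = 0)
    (ha : Tendsto (fun i => (p i).map Prod.fst) U (𝓝 a))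
    (hb : Tendsto (fun i => (p i).map Prod.snd) U (𝓝 b)) :
    ∃ q : FiniteMeasure (X × X),
      Tendsto p U (𝓝 q) ∧ q.map Prod.fst = a ∧ q.map Prod.snd = b := by
  let S : Set (FiniteMeasure (X × X)) := {m | m.mass ≤ a.mass + 1 ∧ m (K ×ˢ L)ᶜ = 0}
  have hS : IsCompact S := isCompact_setOfPred_finiteMeasure_le_of_isCompact _ (hK.prod hL)
  have hpS : ∀ᶠ i in U, p i ∈ S := by
    filter_upwards [hpK, hpL, ha.mass.eventually_le_const (lt_add_one a.mass)]
      with i hpK hpL hmass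
    refine ⟨?_, (FiniteMeasure.null_iff_toMeasure_null _ _).2 (measure_compl_prod_eq_zero
      hK.measurableSet hL.measurableSet ((FiniteMeasure.null_iff_toMeasure_null _ _).1 hpK)
      ((FiniteMeasure.null_iff_toMeasure_null _ _).1 hpL))⟩
    rwa [FiniteMeasure.mass, FiniteMeasure.map_apply _ measurable_fst MeasurableSet.univ,
      preimage_univ] at hmass
  obtain ⟨q, -, hq⟩ := hS.ultrafilter_le_nhds (U.map p) (tendsto_principal.2 hpS)
  replace hq : Tendsto p U (𝓝 q) := hq
  exact ⟨q, hq, tendsto_nhds_unique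
      (FiniteMeasure.tendsto_map_of_tendsto_of_continuous p q hq continuous_fst) ha,
    tendsto_nhds_unique
      (FiniteMeasure.tendsto_map_of_tendsto_of_continuous p q hq continuous_snd) hb⟩

theorem close_of_tendsto_of_nearlyCoupled {ι : Type*} {l : Filter ι} [l.NeBot] {K : Set X}
    (hK : IsCompact K) {δ : ι → ℝ} {κ : ι → ℝ≥0∞} {d : ℝ} {as bs : ι → FiniteMeasure X}
    {a b : FiniteMeasure X} (haK : ∀ i, (as i : Measure X) Kᶜ = 0)
    (hbK : ∀ i, (bs i : Measure X) Kᶜ = 0) (ha : Tendsto as l (𝓝 a)) (hb : Tendsto bs l (𝓝 b))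
    (hδ : Tendsto δ l (𝓝 d)) (hκ : Tendsto κ l (𝓝 0))
    (hC : ∀ᶠ i in l, NearlyCoupled (δ i) (κ i) (as i : Measure X) (bs i)) :
    Close d (a : Measure X) b := by
  intro d' hd'
  have hex : ∀ᶠ i in l, ∃ p : FiniteMeasure (X × X), p.map Prod.fst = as i ∧
      p.map Prod.snd = bs i ∧ (p : Measure (X × X)) {z | δ i < dist z.1 z.2} ≤ κ i := by
    filter_upwards [hC] with i ⟨p, hpa, hpb, hp⟩
    have : IsFiniteMeasure p.fst := hpa ▸ inferInstance
    have : IsFiniteMeasure p := isFiniteMeasure_of_fst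
    exact ⟨⟨p, this⟩, Subtype.ext hpa, Subtype.ext hpb, hp⟩
  obtain ⟨p, hp⟩ := hex.choice
  have hl := Ultrafilter.of_le l
  have hpa : ∀ᶠ i in Ultrafilter.of l, (p i).map Prod.fst = as i :=
    hl (hp.mono fun i hi => hi.1)
  have hpb : ∀ᶠ i in Ultrafilter.of l, (p i).map Prod.snd = bs i :=
    hl (hp.mono fun i hi => hi.2.1)
  obtain ⟨q, hq, rfl, rfl⟩ := exists_tendsto_of_tendsto_map hK hK
    (hpa.mono fun i hi => hi ▸ (FiniteMeasure.null_iff_toMeasure_null _ _).2 (haK i))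
    (hpb.mono fun i hi => hi ▸ (FiniteMeasure.null_iff_toMeasure_null _ _).2 (hbK i))
    ((ha.mono_left hl).congr' (hpa.mono fun i hi => hi.symm))
    ((hb.mono_left hl).congr' (hpb.mono fun i hi => hi.symm))
  refine ⟨q, rfl, rfl, measure_isOpen_le_of_tendsto hq (hκ.mono_left hl)
    (isOpen_lt continuous_const (continuous_fst.dist continuous_snd)) ?_⟩
  filter_upwards [hl hp, hl (hδ.eventually_le_const hd')] with i ⟨_, _, hi⟩ hδi
  exact (measure_mono fun z hz => hδi.trans_lt hz).trans hi

theorem Close.of_tendsto {ι : Type*} {l : Filter ι} [l.NeBot] {K : Set X} (hK : IsCompact K)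
    {δ : ι → ℝ} {d : ℝ} {as bs : ι → FiniteMeasure X} {a b : FiniteMeasure X}
    (haK : ∀ i, (as i : Measure X) Kᶜ = 0) (hbK : ∀ i, (bs i : Measure X) Kᶜ = 0)
    (ha : Tendsto as l (𝓝 a)) (hb : Tendsto bs l (𝓝 b)) (hδ : Tendsto δ l (𝓝 d))
    (hC : ∀ᶠ i in l, Close (δ i) (as i : Measure X) (bs i)) : Close d (a : Measure X) b := by
  intro d' hd'
  refine close_of_tendsto_of_nearlyCoupled hK haK hbK ha hb (hδ.add_const ((d' - d) / 2))
    (tendsto_const_nhds (x := 0)) ?_ d' (by linarith)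
  filter_upwards [hC] with i hi using hi _ (by linarith)

theorem close_of_forall_nearlyCoupled {δ : ℝ} {a b : Measure X} [IsFiniteMeasure a]
    [IsFiniteMeasure b] (ha : IsCompact a.support) (hb : IsCompact b.support)
    (hab : ∀ r > 0, NearlyCoupled (δ + r) (ENNReal.ofReal r) a b) : Close δ a b := by
  have hr : Tendsto (fun r : ℝ => r) (𝓝[>] 0) (𝓝 0) := nhdsWithin_le_nhds
  refine close_of_tendsto_of_nearlyCoupled (l := 𝓝[>] (0 : ℝ)) (as := fun _ => ⟨a, ‹_›⟩)
    (bs := fun _ => ⟨b, ‹_›⟩) (a := ⟨a, ‹_›⟩) (b := ⟨b, ‹_›⟩) (ha.union hb)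
    (fun _ => measure_compl_eq_zero_of_le le_rfl subset_union_left)
    (fun _ => measure_compl_eq_zero_of_le le_rfl subset_union_right)
    tendsto_const_nhds tendsto_const_nhds (by simpa only [add_zero] using hr.const_add δ)
    (by simpa only [ENNReal.ofReal_zero] using ENNReal.tendsto_ofReal hr)
    (eventually_mem_nhdsWithin.mono hab)

end WeakLimits

/-! ### Following a part of a family of measures -/

section Following

variable {X : Type*} [MetricSpace X] [MeasurableSpace X] [BorelSpace X] [SecondCountableTopology X]
  [StandardBorelSpace X]

theorem Close.split {δ : ℝ} {a a' b : Measure X} [IsFiniteMeasure a] (hab : Close δ a b)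
    (ha : IsCompact a.support) (hb : IsCompact b.support) (ha' : a' ≤ a) :
    ∃ b' ≤ b, Close δ a' b' := by
  have : IsFiniteMeasure b := ⟨hab.univ_eq ▸ measure_lt_top a univ⟩
  have : IsFiniteMeasure a' := isFiniteMeasure_of_le a ha'
  have hpos (n : ℕ) : δ < δ + 1 / ((n : ℝ) + 1) := lt_add_of_pos_right δ Nat.one_div_pos_of_nat
  choose c hcb hc using fun n => (hab _ (hpos n)).split ha'
  have hfin (n : ℕ) : IsFiniteMeasure (c n) := isFiniteMeasure_of_le b (hcb n)
  let m (n : ℕ) : FiniteMeasure X := ⟨c n, hfin n⟩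
  let U := Ultrafilter.of (atTop : Filter ℕ)
  obtain ⟨b', hb', hmb'⟩ := (isCompact_setOf_toMeasure_le hb
    Measure.measure_compl_support).ultrafilter_le_nhds (U.map m)
    (tendsto_principal.2 (Eventually.of_forall hcb))
  have hδ : Tendsto (fun n : ℕ => δ + 1 / ((n : ℝ) + 1)) U (𝓝 δ) := by
    simpa only [add_zero] using
      (tendsto_one_div_add_atTop_nhds_zero_nat.const_add δ).mono_left (Ultrafilter.of_le _)
  exact ⟨b', hb', close_of_tendsto_of_nearlyCoupled (as := fun _ => ⟨a', ‹_›⟩) (bs := m)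
    (a := ⟨a', ‹_›⟩) (ha.union hb)
    (fun _ => measure_compl_eq_zero_of_le ha' subset_union_left)
    (fun n => measure_compl_eq_zero_of_le (hcb n) subset_union_right)
    tendsto_const_nhds hmb' hδ tendsto_const_nhds (Eventually.of_forall hc)⟩

variable {ι : Type*} [LinearOrder ι] {τ : ι → ℝ} {ν : ι → Measure X} [∀ i, IsFiniteMeasure (ν i)]
  {i₀ : ι} {a₀ : Measure X}

theorem exists_le_close_finset (hν : ∀ i, IsCompact (ν i).support)
    (hclose : ∀ i j, i ≤ j → Close (τ j - τ i) (ν i) (ν j)) (hi₀ : IsBot i₀) (ha₀ : a₀ ≤ ν i₀)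
    (F : Finset ι) :
    ∃ a : ι → Measure X, (∀ i, a i ≤ ν i) ∧ a i₀ = a₀ ∧
      ∀ i ∈ insert i₀ F, ∀ j ∈ insert i₀ F, i ≤ j → Close (τ j - τ i) (a i) (a j) := by
  induction F using Finset.induction_on_max with
  | empty =>
    refine ⟨Function.update 0 i₀ a₀, update_le_iff.2 ⟨ha₀, fun i _ => Measure.zero_le _⟩,
      Function.update_self .., ?_⟩
    simp only [insert_empty_eq, Finset.mem_singleton]
    rintro _ rfl _ rfl _
    exact Close.refl (sub_self _).ge _
  | insert x F hx ih =>
    obtain ⟨a, haν, ha₀, hac⟩ := ih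
    rcases (hi₀ x).eq_or_lt with rfl | hx₀
    · exact ⟨a, haν, ha₀, by simpa only [Finset.insert_idem] using hac⟩
    have hlt : ∀ i ∈ insert i₀ F, i < x := Finset.forall_mem_insert _ _ _ |>.2 ⟨hx₀, hx⟩
    set m := (insert i₀ F).max' (Finset.insert_nonempty _ _)
    have hm : m ∈ insert i₀ F := Finset.max'_mem _ _
    obtain ⟨a', ha', hma'⟩ := (hclose m x (hlt m hm).le).split (hν m) (hν x) (haν m)
    have hup : ∀ i ∈ insert i₀ F, Function.update a x a' i = a i := fun i hi =>
      Function.update_of_ne (hlt i hi).ne _ _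
    refine ⟨Function.update a x a', update_le_iff.2 ⟨ha', fun i _ => haν i⟩,
      (hup i₀ (Finset.mem_insert_self _ _)).trans ha₀, ?_⟩
    rw [Finset.insert_comm]
    intro i hi' j hj' hij
    rcases Finset.mem_insert.1 hj' with rfl | hj <;> rcases Finset.mem_insert.1 hi' with rfl | hi
    · exact Close.refl (sub_self _).ge _
    · have : IsFiniteMeasure (a i) := isFiniteMeasure_of_le _ (haν i)
      rw [hup i hi, Function.update_self]
      exact ((hac i hi m hm (Finset.le_max' _ _ hi)).trans hma').mono (by linarith)
    · exact absurd hij (hlt j hj).not_ge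
    · rw [hup i hi, hup j hj]
      exact hac i hi j hj hij

theorem exists_le_close (hν : ∀ i, IsCompact (ν i).support)
    (hclose : ∀ i j, i ≤ j → Close (τ j - τ i) (ν i) (ν j)) (hi₀ : IsBot i₀) (ha₀ : a₀ ≤ ν i₀) :
    ∃ a : ι → Measure X, (∀ i, a i ≤ ν i) ∧ a i₀ = a₀ ∧
      ∀ i j, i ≤ j → Close (τ j - τ i) (a i) (a j) := by
  choose A hAν hA₀ hAc using exists_le_close_finset hν hclose hi₀ ha₀
  have hfin (F : Finset ι) (i : ι) : IsFiniteMeasure (A F i) := isFiniteMeasure_of_le _ (hAν F i)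
  let m (F : Finset ι) (i : ι) : FiniteMeasure X := ⟨A F i, hfin F i⟩
  let U := Ultrafilter.of (atTop : Filter (Finset ι))
  obtain ⟨a, haν, hma⟩ := (isCompact_univ_pi fun i => isCompact_setOf_toMeasure_le (hν i)
    Measure.measure_compl_support).ultrafilter_le_nhds (U.map m)
    (tendsto_principal.2 (Eventually.of_forall fun F i _ => hAν F i))
  replace hma : ∀ i, Tendsto (fun F => m F i) U (𝓝 (a i)) := tendsto_pi_nhds.1 hma
  have hmem (i : ι) : ∀ᶠ F in (U : Filter (Finset ι)), i ∈ insert i₀ F :=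
    Ultrafilter.of_le _ <| (eventually_ge_atTop {i}).mono fun F hF =>
      Finset.mem_insert_of_mem (Finset.singleton_subset_iff.1 hF)
  refine ⟨fun i => a i, fun i => haν i (mem_univ i), ?_, fun i j hij => ?_⟩
  · have : IsFiniteMeasure a₀ := isFiniteMeasure_of_le _ ha₀
    let m₀ : FiniteMeasure X := ⟨a₀, this⟩
    have hm₀ (F : Finset ι) : m₀ = m F i₀ := Subtype.ext (hA₀ F).symm
    have ham : a i₀ = m₀ := tendsto_nhds_unique (hma i₀) (tendsto_const_nhds.congr hm₀)
    exact congrArg Subtype.val ham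
  · refine Close.of_tendsto ((hν i).union (hν j))
      (fun F => measure_compl_eq_zero_of_le (hAν F i) subset_union_left)
      (fun F => measure_compl_eq_zero_of_le (hAν F j) subset_union_right)
      (hma i) (hma j) tendsto_const_nhds ?_
    filter_upwards [hmem i, hmem j] with F hi hj using hAc F i hi j hj hij

end Following

/-! ### The distance of dominated measures -/

/-- The two properties of a gauge function that determine how curves behave: `h ε = o(ε)` fixes the
mass along a curve, and `h → ∞` makes all distances finite. -/
structure IsWeakGauge (h : ℝ → ℝ) : Prop where
  tendsto_div : Tendsto (fun ε => h ε / ε) (𝓝[>] 0) (𝓝 0)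
  tendsto_atTop : Tendsto h atTop atTop

theorem IsGauge.isWeakGauge {h : ℝ → ℝ} (hh : IsGauge h) : IsWeakGauge h :=
  ⟨hh.tendsto_div, hh.tendsto_atTop⟩

theorem inv_max_mul_mul_eq_min {x y : ℝ≥0∞} (hx : x ≠ ∞) (hy : y ≠ ∞) :
    (max x y)⁻¹ * (x * y) = min x y := by
  rcases eq_or_ne (max x y) 0 with h0 | h0
  · have hx0 : x = 0 := nonpos_iff_eq_zero.1 (h0 ▸ le_max_left x y)
    rw [hx0, zero_mul, mul_zero, zero_min]
  · rw [← min_mul_max x y, mul_comm (min x y), ← mul_assoc,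
      ENNReal.inv_mul_cancel h0 (max_ne_top hx hy), one_mul]

theorem nearlyCoupled_of_fst_le {X : Type*} [PseudoMetricSpace X] [MeasurableSpace X] {δ : ℝ}
    {κ : ℝ≥0∞} {a b : Measure X} {q : Measure (X × X)} [IsFiniteMeasure a]
    (hab : a univ = b univ) (hqa : q.fst ≤ a) (hqb : q.snd ≤ b)
    (hq : q {z | δ < dist z.1 z.2} = 0) (hκ : a univ ≤ q univ + κ) :
    NearlyCoupled δ κ a b := by
  have : IsFiniteMeasure b := ⟨hab ▸ measure_lt_top a univ⟩
  have : IsFiniteMeasure q.fst := isFiniteMeasure_of_le _ hqa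
  have : IsFiniteMeasure q := isFiniteMeasure_of_fst
  obtain ⟨a', rfl⟩ : ∃ a', a = q.fst + a' :=
    ⟨a - q.fst, by rw [add_comm, Measure.sub_add_cancel_of_le hqa]⟩
  obtain ⟨b', rfl⟩ : ∃ b', b = q.snd + b' :=
    ⟨b - q.snd, by rw [add_comm, Measure.sub_add_cancel_of_le hqb]⟩
  have : IsFiniteMeasure a' := isFiniteMeasure_of_le (q.fst + a') (Measure.le_add_left le_rfl)
  have : IsFiniteMeasure b' := isFiniteMeasure_of_le (q.snd + b') (Measure.le_add_left le_rfl)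
  rw [Measure.add_apply, Measure.fst_univ] at hab hκ
  rw [Measure.add_apply, Measure.snd_univ] at hab
  have hab' : a' univ = b' univ := (ENNReal.add_right_inj (measure_ne_top q univ)).1 hab
  have hκ' : a' univ ≤ κ := (ENNReal.add_le_add_iff_left (measure_ne_top q univ)).1 hκ
  have hone (c : Measure X) (hc : c univ = a' univ) : ((a' univ)⁻¹ * a' univ) • c = c := by
    rcases eq_or_ne (a' univ) 0 with h0 | h0
    · rw [Measure.measure_univ_eq_zero.1 (hc.trans h0), smul_zero]
    · rw [ENNReal.inv_mul_cancel h0 (measure_ne_top _ _), one_smul]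
  refine ⟨q + (a' univ)⁻¹ • a'.prod b', ?_, ?_, ?_⟩
  · rw [Measure.fst, Measure.map_add _ _ measurable_fst, Measure.map_smul, Measure.map_fst_prod,
      smul_smul, ← hab', hone a' rfl, Measure.fst]
  · rw [Measure.snd, Measure.map_add _ _ measurable_snd, Measure.map_smul, Measure.map_snd_prod,
      smul_smul, hone b' hab'.symm, Measure.snd]
  · rw [Measure.add_apply, hq, zero_add]
    refine (measure_mono (subset_univ _)).trans ?_
    rw [Measure.smul_apply, ← univ_prod_univ, Measure.prod_prod, smul_eq_mul, ← mul_assoc, ← hab']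
    exact (mul_le_of_le_one_left zero_le (ENNReal.inv_mul_le_one _)).trans hκ'

theorem support_map_restrict_subset {Ω X : Type*} [MeasurableSpace Ω] [TopologicalSpace X]
    [MeasurableSpace X] [OpensMeasurableSpace X] {p : Measure Ω} {S : Set Ω} {f : Ω → X}
    (hf : Measurable f) : ((p.restrict S).map f).support ⊆ closure (f '' S) := by
  refine Measure.support_subset_of_isClosed isClosed_closure ?_
  rw [mem_ae_iff, Measure.map_apply hf isClosed_closure.measurableSet.compl,
    Measure.restrict_apply (hf isClosed_closure.measurableSet.compl)]
  refine measure_mono_null (t := ∅) ?_ measure_empty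
  exact fun z hz => hz.1 (subset_closure (mem_image_of_mem f hz.2))

theorem dist_le_of_mem_image_union {X : Type*} [PseudoMetricSpace X] {S : Set (X × X)} {δ r : ℝ}
    (hS : ∀ z ∈ S, ∀ w ∈ S, dist z w ≤ r) {z : X × X} (hz : z ∈ S) (hzδ : dist z.1 z.2 ≤ δ) :
    ∀ x ∈ Prod.fst '' S ∪ Prod.snd '' S, ∀ y ∈ Prod.fst '' S ∪ Prod.snd '' S,
      dist x y ≤ δ + 2 * r := by
  have hr : 0 ≤ r := dist_nonneg.trans (hS z hz z hz)
  have hδ : 0 ≤ δ := dist_nonneg.trans hzδ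
  have hfst {v w : X × X} (hv : v ∈ S) (hw : w ∈ S) : dist v.1 w.1 ≤ r :=
    (le_max_left _ _).trans (hS v hv w hw)
  have hsnd {v w : X × X} (hv : v ∈ S) (hw : w ∈ S) : dist v.2 w.2 ≤ r :=
    (le_max_right _ _).trans (hS v hv w hw)
  have hmixed {v w : X × X} (hv : v ∈ S) (hw : w ∈ S) : dist v.1 w.2 ≤ δ + 2 * r := by
    linarith [dist_triangle4 v.1 z.1 z.2 w.2, hfst hv hz, hsnd hz hw]
  rintro _ (⟨v, hv, rfl⟩ | ⟨v, hv, rfl⟩) _ (⟨w, hw, rfl⟩ | ⟨w, hw, rfl⟩)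
  · linarith [hfst hv hw]
  · exact hmixed hv hw
  · rw [dist_comm]
    exact hmixed hw hv
  · linarith [hsnd hv hw]

theorem diam_le_of_restrict_marginals {X : Type*} [PseudoMetricSpace X] [MeasurableSpace X]
    [OpensMeasurableSpace X] {p : Measure (X × X)} {S : Set (X × X)} {δ r : ℝ}
    (hS : ∀ z ∈ S, ∀ w ∈ S, dist z w ≤ r) (hδr : 0 ≤ δ + 2 * r)
    (hp : p {z | δ < dist z.1 z.2} = 0) :
    Metric.diam ((p.restrict S).fst.support ∪ (p.restrict S).snd.support) ≤ δ + 2 * r := by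
  rcases eq_or_ne (p S) 0 with hpS | hpS
  · simpa [Measure.restrict_eq_zero.2 hpS, Measure.fst, Measure.snd] using hδr
  obtain ⟨z, hz, hzδ⟩ : ∃ z ∈ S, dist z.1 z.2 ≤ δ := by
    by_contra! hfar
    exact hpS (measure_mono_null hfar hp)
  have hdist := dist_le_of_mem_image_union hS hz hzδ
  have hbdd : Bornology.IsBounded (Prod.fst '' S ∪ Prod.snd '' S) :=
    Metric.isBounded_iff.2 ⟨_, hdist⟩
  refine (Metric.diam_mono ?_ hbdd.closure).trans
    ((Metric.diam_closure _).le.trans (Metric.diam_le_of_forall_dist_le hδr hdist))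
  rw [closure_union]
  exact union_subset_union (support_map_restrict_subset measurable_fst)
    (support_map_restrict_subset measurable_snd)

section PartialCoupling

variable {X : Type*} [MeasurableSpace X] {νs ηs : ℕ → Measure X}

/-- The coupling of the parts of two measures that a decomposition matches: each pair of pieces
contributes a multiple of its product measure, of the mass of the lighter piece. -/
noncomputable def partialCoupling (νs ηs : ℕ → Measure X) : Measure (X × X) :=
  Measure.sum fun i => (max (νs i univ) (ηs i univ))⁻¹ • (νs i).prod (ηs i)

theorem partialCoupling_fst_le [∀ i, SFinite (ηs i)] :
    (partialCoupling νs ηs).fst ≤ Measure.sum νs := by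
  refine Measure.le_iff.2 fun s hs => ?_
  rw [partialCoupling, Measure.fst, Measure.map_sum measurable_fst.aemeasurable,
    Measure.sum_apply _ hs, Measure.sum_apply _ hs]
  refine ENNReal.tsum_le_tsum fun i => ?_
  rw [Measure.map_smul, Measure.map_fst_prod, Measure.smul_apply, Measure.smul_apply, smul_eq_mul,
    smul_eq_mul, ← mul_assoc]
  refine mul_le_of_le_one_left zero_le ?_
  exact (mul_le_mul_right (le_max_right _ _) _).trans (ENNReal.inv_mul_le_one _)

theorem partialCoupling_map_swap [∀ i, SFinite (νs i)] [∀ i, SFinite (ηs i)] :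
    (partialCoupling νs ηs).map Prod.swap = partialCoupling ηs νs := by
  simp only [partialCoupling, Measure.map_sum measurable_swap.aemeasurable, Measure.map_smul,
    Measure.prod_swap, max_comm]

theorem partialCoupling_snd_le [∀ i, SFinite (νs i)] [∀ i, SFinite (ηs i)] :
    (partialCoupling νs ηs).snd ≤ Measure.sum ηs := by
  rw [← Measure.fst_map_swap, partialCoupling_map_swap]
  exact partialCoupling_fst_le

end PartialCoupling

section Distance

variable {X : Type*} [MetricSpace X] [MeasurableSpace X] {μ ν η : Measure X} {h : ℝ → ℝ} {ε δ : ℝ}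
  {νs ηs : ℕ → Measure X}

theorem mem_domMeasures_of_le {a : Measure X} (hν : ν ∈ DomMeasures μ) (ha : a ≤ ν) :
    a ∈ DomMeasures μ :=
  ⟨ha.trans hν.1, hν.2.of_isClosed_subset Measure.isClosed_support (Measure.support_mono ha)⟩

theorem zero_mem_domMeasures (μ : Measure X) : (0 : Measure X) ∈ DomMeasures μ :=
  ⟨Measure.zero_le μ, by simp only [Measure.support_zero, isCompact_empty]⟩

theorem IsDecomposition.symm (hd : IsDecomposition μ ε δ ν η νs ηs) :
    IsDecomposition μ ε δ η ν ηs νs where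
  left_mem := hd.right_mem
  right_mem := hd.left_mem
  left_sum := hd.right_sum
  right_sum := hd.left_sum
  mass_le := by simpa only [abs_sub_comm] using hd.mass_le
  diam_le i := by simpa only [union_comm] using hd.diam_le i

theorem IsDecomposition.mono {ε' δ' : ℝ} (hd : IsDecomposition μ ε δ ν η νs ηs) (hε : ε ≤ ε')
    (hδ : δ ≤ δ') : IsDecomposition μ ε' δ' ν η νs ηs :=
  { hd with
    mass_le := hd.mass_le.trans (ENNReal.ofReal_le_ofReal hδ)
    diam_le := fun i => (hd.diam_le i).trans hε }

theorem domDist_comm (μ : Measure X) (h : ℝ → ℝ) (ν η : Measure X) :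
    domDist μ h ν η = domDist μ h η ν := by
  unfold domDist
  congr 1
  ext ε
  constructor <;> rintro ⟨hε, νs, ηs, hd⟩ <;> exact ⟨hε, ηs, νs, hd.symm⟩

theorem exists_isDecomposition (hh : Tendsto h atTop atTop) (hν : ν ∈ DomMeasures μ)
    (hη : η ∈ DomMeasures μ) :
    ∃ ε > 0, ∃ νs ηs : ℕ → Measure X, IsDecomposition μ ε (h ε) ν η νs ηs := by
  obtain ⟨ε, hmass, hdiam, hε⟩ := ((hh.eventually_ge_atTop
    |ν.real univ - η.real univ|).and ((eventually_ge_atTop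
      (Metric.diam (ν.support ∪ η.support))).and (eventually_gt_atTop 0))).exists
  have hsum (a : Measure X) : a = Measure.sum (Pi.single (0 : ℕ) a) := by
    ext s hs
    rw [Measure.sum_apply _ hs, tsum_eq_single 0 fun i hi => by simp [Pi.single_eq_of_ne hi],
      Pi.single_eq_same]
  have hmem {a : Measure X} (ha : a ∈ DomMeasures μ) (i : ℕ) :
      (Pi.single 0 a : ℕ → Measure X) i ∈ DomMeasures μ := by
    rcases eq_or_ne i 0 with rfl | hi
    · rwa [Pi.single_eq_same]
    · rw [Pi.single_eq_of_ne hi]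
      exact zero_mem_domMeasures μ
  refine ⟨ε, hε, Pi.single 0 ν, Pi.single 0 η, hmem hν, hmem hη, hsum ν, hsum η, ?_, fun i => ?_⟩
  · rw [tsum_eq_single 0 fun i hi => by simp [Pi.single_eq_of_ne hi]]
    simpa only [Pi.single_eq_same] using ENNReal.ofReal_le_ofReal hmass
  · rcases eq_or_ne i 0 with rfl | hi
    · simpa only [Pi.single_eq_same] using hdiam
    · simpa [Pi.single_eq_of_ne hi] using hε.le

theorem eventually_exists_isDecomposition (hh : IsWeakGauge h) {τ : ℝ} (hτ : 0 < τ) :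
    ∀ᶠ ε in 𝓝[>] 0, ∀ ν ∈ DomMeasures μ, ∀ η ∈ DomMeasures μ, domDist μ h ν η < ε →
      ∃ νs ηs : ℕ → Measure X, IsDecomposition μ ε (τ * ε) ν η νs ηs := by
  obtain ⟨ρ, hρ, hsmall⟩ := mem_nhdsGT_iff_exists_Ioo_subset.1
    (hh.tendsto_div.eventually_lt_const hτ)
  filter_upwards [Ioo_mem_nhdsGT hρ] with ε hε ν hν η hη hlt
  obtain ⟨ε', ⟨hε', νs, ηs, hd⟩, hε'ε⟩ :=
    exists_lt_of_csInf_lt (exists_isDecomposition hh.tendsto_atTop hν hη) hlt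
  have hhε' : h ε' < τ * ε' := (div_lt_iff₀ hε').1 (hsmall ⟨hε', hε'ε.trans hε.2⟩)
  exact ⟨νs, ηs, hd.mono hε'ε.le (hhε'.le.trans (mul_le_mul_of_nonneg_left hε'ε.le hτ.le))⟩

variable [SecondCountableTopology X]

theorem isFiniteMeasure_of_mem_domMeasures [IsLocallyFiniteMeasure μ] (hν : ν ∈ DomMeasures μ) :
    IsFiniteMeasure ν := by
  refine ⟨?_⟩
  rw [← union_compl_self ν.support]
  refine (measure_union_le _ _).trans_lt ?_
  rw [Measure.measure_compl_support, add_zero]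
  exact (hν.1 _).trans_lt hν.2.measure_lt_top

theorem IsDecomposition.left_univ_le [IsLocallyFiniteMeasure μ]
    (hd : IsDecomposition μ ε δ ν η νs ηs) : ν univ ≤ η univ + ENNReal.ofReal δ := by
  rw [hd.left_sum, hd.right_sum, Measure.sum_apply _ .univ, Measure.sum_apply _ .univ]
  refine le_trans ?_ (add_le_add le_rfl hd.mass_le)
  rw [← ENNReal.tsum_add]
  refine ENNReal.tsum_le_tsum fun i => ?_
  have := isFiniteMeasure_of_mem_domMeasures (hd.left_mem i)
  have := isFiniteMeasure_of_mem_domMeasures (hd.right_mem i)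
  rw [← ofReal_measureReal, ← ofReal_measureReal,
    ← ENNReal.ofReal_add measureReal_nonneg (abs_nonneg _)]
  exact ENNReal.ofReal_le_ofReal (by linarith [le_abs_self ((νs i).real univ - (ηs i).real univ)])

theorem IsDecomposition.abs_mass_sub_le [IsLocallyFiniteMeasure μ] (hδ : 0 ≤ δ)
    (hν : ν ∈ DomMeasures μ) (hη : η ∈ DomMeasures μ) (hd : IsDecomposition μ ε δ ν η νs ηs) :
    |ν.real univ - η.real univ| ≤ δ := by
  have := isFiniteMeasure_of_mem_domMeasures hν
  have := isFiniteMeasure_of_mem_domMeasures hη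
  have hle := hd.left_univ_le
  have hge := hd.symm.left_univ_le
  rw [← ofReal_measureReal (μ := ν), ← ofReal_measureReal (μ := η),
    ← ENNReal.ofReal_add measureReal_nonneg hδ,
    ENNReal.ofReal_le_ofReal_iff (add_nonneg measureReal_nonneg hδ)] at hle hge
  rw [abs_le]
  constructor <;> linarith

theorem IsDecomposition.partialCoupling_lt_dist [OpensMeasurableSpace X]
    (hd : IsDecomposition μ ε δ ν η νs ηs) [∀ i, SFinite (ηs i)] :
    partialCoupling νs ηs {z | ε < dist z.1 z.2} = 0 := by
  rw [partialCoupling, Measure.sum_apply _ (measurableSet_lt_dist ε)]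
  refine ENNReal.tsum_eq_zero.2 fun i => ?_
  rw [Measure.smul_apply, smul_eq_mul]
  refine mul_eq_zero_of_right _ (measure_mono_null
    (t := ((νs i).support ×ˢ (ηs i).support)ᶜ) ?_ ?_)
  · rintro ⟨x, y⟩ hxy ⟨hx, hy⟩
    have hbdd := ((hd.left_mem i).2.union (hd.right_mem i).2).isBounded
    have hdist := Metric.dist_le_diam_of_mem hbdd (Or.inl hx) (Or.inr hy)
    exact hxy.not_ge (hdist.trans (hd.diam_le i))
  · rw [compl_prod_eq_union]
    refine measure_union_null ?_ ?_
    · rw [Measure.prod_prod, Measure.measure_compl_support, zero_mul]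
    · rw [Measure.prod_prod, Measure.measure_compl_support, mul_zero]

theorem IsDecomposition.left_univ_le_partialCoupling [IsLocallyFiniteMeasure μ]
    (hd : IsDecomposition μ ε δ ν η νs ηs) :
    ν univ ≤ partialCoupling νs ηs univ + ENNReal.ofReal δ := by
  rw [hd.left_sum, partialCoupling, Measure.sum_apply _ .univ, Measure.sum_apply _ .univ]
  refine le_trans ?_ (add_le_add le_rfl hd.mass_le)
  rw [← ENNReal.tsum_add]
  refine ENNReal.tsum_le_tsum fun i => ?_
  have := isFiniteMeasure_of_mem_domMeasures (hd.left_mem i)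
  have := isFiniteMeasure_of_mem_domMeasures (hd.right_mem i)
  rw [Measure.smul_apply, ← univ_prod_univ, Measure.prod_prod, smul_eq_mul,
    inv_max_mul_mul_eq_min (measure_ne_top _ _) (measure_ne_top _ _), ← ofReal_measureReal,
    ← ofReal_measureReal, ← ENNReal.ofReal_min,
    ← ENNReal.ofReal_add (le_min measureReal_nonneg measureReal_nonneg) (abs_nonneg _)]
  refine ENNReal.ofReal_le_ofReal ?_
  rcases le_total ((νs i).real univ) ((ηs i).real univ) with hle | hle
  · rw [min_eq_left hle]
    exact le_add_of_nonneg_right (abs_nonneg _)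
  · rw [min_eq_right hle]
    linarith [le_abs_self ((νs i).real univ - (ηs i).real univ)]

variable [OpensMeasurableSpace X]

theorem IsDecomposition.nearlyCoupled [IsLocallyFiniteMeasure μ] (hν : ν ∈ DomMeasures μ)
    (hd : IsDecomposition μ ε δ ν η νs ηs) (hm : ν univ = η univ) :
    NearlyCoupled ε (ENNReal.ofReal δ) ν η := by
  have := isFiniteMeasure_of_mem_domMeasures hν
  have (i : ℕ) := isFiniteMeasure_of_mem_domMeasures (hd.left_mem i)
  have (i : ℕ) := isFiniteMeasure_of_mem_domMeasures (hd.right_mem i)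
  exact nearlyCoupled_of_fst_le hm (partialCoupling_fst_le.trans_eq hd.left_sum.symm)
    (partialCoupling_snd_le.trans_eq hd.right_sum.symm) hd.partialCoupling_lt_dist
    hd.left_univ_le_partialCoupling

theorem domDist_le_of_close (hδ : 0 ≤ δ) (hν : ν ∈ DomMeasures μ) (hη : η ∈ DomMeasures μ)
    (hc : Close δ ν η) : domDist μ h ν η ≤ δ := by
  refine le_of_forall_pos_le_add fun r hr => csInf_le ⟨0, fun ε hε => hε.1.le⟩ ⟨by linarith, ?_⟩
  obtain ⟨p, rfl, rfl, hp⟩ := hc (δ + r / 3) (by linarith)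
  obtain ⟨S, hSm, hSb, hSd, hS, hSdisj⟩ :=
    SeparableSpace.exists_measurable_partition_diam_le (X × X) (show 0 < r / 3 by linarith)
  have hsum : p = Measure.sum fun k => p.restrict (S k) := by
    rw [← Measure.restrict_iUnion hSdisj hSm, hS, Measure.restrict_univ]
  refine ⟨fun k => (p.restrict (S k)).fst, fun k => (p.restrict (S k)).snd,
    fun k => mem_domMeasures_of_le hν (Measure.map_mono Measure.restrict_le_self measurable_fst),
    fun k => mem_domMeasures_of_le hη (Measure.map_mono Measure.restrict_le_self measurable_snd),
    ?_, ?_, ?_, fun k => ?_⟩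
  · simp only [Measure.fst]
    rw [← Measure.map_sum measurable_fst.aemeasurable, ← hsum]
  · simp only [Measure.snd]
    rw [← Measure.map_sum measurable_snd.aemeasurable, ← hsum]
  · simp [Measure.real, Measure.fst_univ, Measure.snd_univ]
  · have hdist : ∀ z ∈ S k, ∀ w ∈ S k, dist z w ≤ r / 3 := fun z hz w hw =>
      (Metric.dist_le_diam_of_mem (hSb k) hz hw).trans (hSd k)
    have := diam_le_of_restrict_marginals hdist (by linarith) (nonpos_iff_eq_zero.1 hp)
    linarith

end Distance

/-! ### Curves of measures -/

theorem tendsto_div_natCast_add_one_nhdsGT {t : ℝ} (ht : 0 < t) :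
    Tendsto (fun n : ℕ => t / ((n : ℝ) + 1)) atTop (𝓝[>] 0) :=
  tendsto_nhdsWithin_iff.2 ⟨by
      simpa [div_eq_mul_inv] using
        (tendsto_one_div_add_atTop_nhds_zero_nat (𝕜 := ℝ)).const_mul t,
    Eventually.of_forall fun n => div_pos ht n.cast_add_one_pos⟩

theorem eq_of_forall_eventually_abs_sub_le {φ : ℝ → ℝ} {b : ℝ}
    (hφ : ∀ τ > 0, ∀ᶠ r in 𝓝[>] 0, ∀ s, 0 ≤ s → s + r ≤ b → |φ (s + r) - φ s| ≤ τ * r)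
    {t : ℝ} (ht : t ∈ Icc 0 b) : φ t = φ 0 := by
  rcases ht.1.eq_or_lt with rfl | ht0
  · rfl
  refine eq_of_abs_sub_nonpos (le_of_forall_pos_le_add fun τ hτ => ?_)
  obtain ⟨n, hn⟩ :=
    ((tendsto_div_natCast_add_one_nhdsGT ht0).eventually (hφ _ (div_pos hτ ht0))).exists
  have hn0 : (0 : ℝ) < (n : ℝ) + 1 := n.cast_add_one_pos
  set r := t / ((n : ℝ) + 1)
  have hnr : ((n : ℝ) + 1) * r = t := mul_div_cancel₀ t hn0.ne'
  have hr0 : 0 < r := div_pos ht0 hn0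
  have hstep : ∀ {i : ℕ}, i < n + 1 → dist (φ (i * r)) (φ ((i + 1 : ℕ) * r)) ≤ τ / t * r := by
    intro i hi
    have hir : ((i : ℝ) + 1) * r ≤ b :=
      (mul_le_mul_of_nonneg_right (by exact_mod_cast hi) hr0.le).trans (hnr.trans_le ht.2)
    rw [dist_comm, Real.dist_eq, Nat.cast_add_one, add_one_mul]
    exact hn _ (by positivity) (by rwa [← add_one_mul])
  have hsum := dist_le_range_sum_of_dist_le (f := fun i : ℕ => φ (i * r)) (n + 1) hstep
  rw [Finset.sum_const, Finset.card_range, nsmul_eq_mul, dist_comm, Real.dist_eq, Nat.cast_add_one,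
    hnr, Nat.cast_zero, zero_mul, mul_left_comm, hnr, div_mul_cancel₀ _ ht0.ne'] at hsum
  rwa [zero_add]

section Curves

variable {X : Type*} [MetricSpace X] [MeasurableSpace X] {μ : Measure X} {h : ℝ → ℝ} {b : ℝ}
  {ν : ℝ → NonzeroDom μ}

theorem IsCurve.shift (hν : IsCurve μ h b ν) {t : ℝ} (ht : t ∈ Icc 0 b) :
    IsCurve μ h (b - t) fun s => ν (t + s) where
  nonneg := sub_nonneg.2 ht.2
  lipschitz r s hr hrs hs := by
    have := hν.lipschitz (t + r) (t + s) (by linarith [ht.1]) (by linarith) (by linarith)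
    linarith

theorem IsCurve.reverse (hν : IsCurve μ h b ν) {t : ℝ} (ht : t ∈ Icc 0 b) :
    IsCurve μ h t fun s => ν (t - s) where
  nonneg := ht.1
  lipschitz r s hr hrs hs := by
    have := hν.lipschitz (t - s) (t - r) (by linarith) (by linarith) (by linarith [ht.2])
    rw [domDist_comm]
    linarith

variable [SecondCountableTopology X] [IsLocallyFiniteMeasure μ]

instance NonzeroDom.isFiniteMeasure (η : NonzeroDom μ) : IsFiniteMeasure η.1 :=
  isFiniteMeasure_of_mem_domMeasures η.2.1

theorem NonzeroDom.mass_pos (η : NonzeroDom μ) : 0 < η.1.real univ :=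
  ENNReal.toReal_pos (Measure.measure_univ_ne_zero.2 η.2.2) (measure_ne_top _ _)

theorem IsCurve.mass_eq (hh : IsWeakGauge h) (hν : IsCurve μ h b ν) {t : ℝ} (ht : t ∈ Icc 0 b) :
    (ν t).1.real univ = (ν 0).1.real univ := by
  refine eq_of_forall_eventually_abs_sub_le (φ := fun t => (ν t).1.real univ)
    (fun τ hτ => ?_) ht
  filter_upwards [eventually_nhdsGT_zero_mul_left two_pos
    (eventually_exists_isDecomposition (μ := μ) hh (half_pos hτ)),
    self_mem_nhdsWithin] with r hr hr0 s hs hsr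
  have hr0 : 0 < r := hr0
  obtain ⟨νs, ηs, hd⟩ := hr _ (ν (s + r)).2.1 _ (ν s).2.1
    ((hν.lipschitz s (s + r) hs (by linarith) hsr).trans_lt (by linarith))
  refine (hd.abs_mass_sub_le (by positivity) (ν (s + r)).2.1 (ν s).2.1).trans_eq ?_
  ring

theorem IsCurve.univ_eq (hh : IsWeakGauge h) (hν : IsCurve μ h b ν) {s t : ℝ}
    (hs : s ∈ Icc 0 b) (ht : t ∈ Icc 0 b) : (ν s).1 univ = (ν t).1 univ := by
  rw [← ofReal_measureReal, hν.mass_eq hh hs, ← hν.mass_eq hh ht, ofReal_measureReal]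

variable [BorelSpace X]

theorem IsCurve.eventually_nearlyCoupled (hh : IsWeakGauge h) (hν : IsCurve μ h b ν) {τ : ℝ}
    (hτ : 0 < τ) : ∀ᶠ ε in 𝓝[>] 0, ∀ s t, 0 ≤ s → s ≤ t → t ≤ b → t - s < ε →
      NearlyCoupled ε (ENNReal.ofReal (τ * ε)) (ν s).1 (ν t).1 := by
  filter_upwards [eventually_exists_isDecomposition (μ := μ) hh hτ] with ε hε s t hs hst ht hlt
  obtain ⟨νs, ηs, hd⟩ := hε _ (ν t).2.1 _ (ν s).2.1 ((hν.lipschitz s t hs hst ht).trans_lt hlt)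
  exact (hd.nearlyCoupled (ν t).2.1
    (hν.univ_eq hh ⟨hs.trans hst, ht⟩ ⟨hs, hst.trans ht⟩)).symm

variable [StandardBorelSpace X]

theorem IsCurve.close (hh : IsWeakGauge h) (hν : IsCurve μ h b ν) {s t : ℝ} (hs : 0 ≤ s)
    (hst : s ≤ t) (ht : t ≤ b) : Close (t - s) (ν s).1 (ν t).1 := by
  refine close_of_forall_nearlyCoupled (ν s).2.1.2 (ν t).2.1.2 fun r hr => ?_
  have hδ : 0 < t - s + r := by linarith
  obtain ⟨n, hn⟩ := ((tendsto_div_natCast_add_one_nhdsGT hδ).eventually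
    (hν.eventually_nearlyCoupled hh (div_pos hr hδ))).exists
  have hn0 : (0 : ℝ) < (n : ℝ) + 1 := n.cast_add_one_pos
  set ε := (t - s + r) / ((n : ℝ) + 1)
  set ρ := (t - s) / ((n : ℝ) + 1)
  have hnρ : ((n : ℝ) + 1) * ρ = t - s := mul_div_cancel₀ _ hn0.ne'
  have hnε : ((n : ℝ) + 1) * ε = t - s + r := mul_div_cancel₀ _ hn0.ne'
  have hρ : 0 ≤ ρ := div_nonneg (by linarith) hn0.le
  have hρε : ρ < ε := div_lt_div_of_pos_right (by linarith) hn0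
  have hstep : ∀ i < n + 1, NearlyCoupled ε (ENNReal.ofReal (r / (t - s + r) * ε))
      (ν (s + (i : ℝ) * ρ)).1 (ν (s + (i + 1 : ℕ) * ρ)).1 := fun i hi => by
    have hiρ : ((i + 1 : ℕ) : ℝ) * ρ ≤ t - s :=
      (mul_le_mul_of_nonneg_right (by exact_mod_cast hi) hρ).trans_eq hnρ
    exact hn _ _ (by positivity) (by push_cast; linarith) (by linarith) (by push_cast; linarith)
  have hchain := nearlyCoupled_of_forall_succ (a := fun i : ℕ => (ν (s + (i : ℝ) * ρ)).1) hstep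
  simp only [Nat.cast_zero, zero_mul, add_zero, Nat.cast_add_one, hnρ, add_sub_cancel] at hchain
  refine hchain.mono hnε.le ?_
  rw [← Nat.cast_add_one, ← ENNReal.ofReal_natCast, ← ENNReal.ofReal_mul (by positivity)]
  refine ENNReal.ofReal_le_ofReal ?_
  rw [Nat.cast_add_one, mul_left_comm, hnε, div_mul_cancel₀ _ hδ.ne']

theorem IsCurve.exists_split (hh : IsWeakGauge h) (hν : IsCurve μ h b ν) {a₀ : Measure X}
    (ha₀ : a₀ ≤ (ν 0).1) (hne : a₀ ≠ 0) :
    ∃ a : ℝ → NonzeroDom μ, IsCurve μ h b a ∧ (a 0).1 = a₀ ∧ ∀ t ∈ Icc 0 b, (a t).1 ≤ (ν t).1 := by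
  obtain ⟨a, haν, ha0, hclose⟩ := exists_le_close (ι := Icc 0 b) (τ := (↑))
    (ν := fun t => (ν t).1) (i₀ := ⟨0, left_mem_Icc.2 hν.nonneg⟩) (fun t => (ν t).2.1.2)
    (fun s t hst => hν.close hh s.2.1 hst t.2.2) (fun t => t.2.1) ha₀
  have hdom : ∀ t, a t ∈ DomMeasures μ := fun t => mem_domMeasures_of_le (ν t).2.1 (haν t)
  have hne' : ∀ t, a t ≠ 0 := fun t ht => hne <| by
    have := (hclose ⟨0, left_mem_Icc.2 hν.nonneg⟩ t t.2.1).univ_eq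
    rwa [ha0, ht, Measure.coe_zero, Pi.zero_apply, Measure.measure_univ_eq_zero] at this
  let a' (t : Icc 0 b) : NonzeroDom μ := ⟨a t, hdom t, hne' t⟩
  refine ⟨IccExtend hν.nonneg a', ⟨hν.nonneg, fun s t hs hst ht => ?_⟩, ?_, fun t ht => ?_⟩
  · rw [IccExtend_of_mem _ _ ⟨hs, hst.trans ht⟩, IccExtend_of_mem _ _ ⟨hs.trans hst, ht⟩,
      domDist_comm]
    exact domDist_le_of_close (sub_nonneg.2 hst) (hdom _) (hdom _) (hclose ⟨s, _⟩ ⟨t, _⟩ hst)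
  · rw [IccExtend_left]
    exact ha0
  · rw [IccExtend_of_mem _ _ ht]
    exact haν _

end Curves

/-! ### Integrals along curves -/

theorem le_restrict_of_measure_compl_eq_zero {α : Type*} [MeasurableSpace α] {μ ν : Measure α}
    (hν : ν ≤ μ) {K : Set α} (hK : ν Kᶜ = 0) : ν ≤ μ.restrict K := by
  have : ν.restrict K = ν := Measure.restrict_eq_self_of_ae_mem (mem_ae_iff.2 hK)
  exact this ▸ Measure.restrict_mono le_rfl hν

theorem integral_congr_of_le {α : Type*} [MeasurableSpace α] {μ ν : Measure α} {f f' : α → ℝ}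
    (hν : ν ≤ μ) (hf : f =ᵐ[μ] f') : ∫ x, f x ∂ν = ∫ x, f' x ∂ν :=
  integral_congr_ae (Measure.absolutelyContinuous_of_le hν hf)

theorem abs_integral_sub_integral_le_of_le {α : Type*} [MeasurableSpace α] {μ ν : Measure α}
    {f f' : α → ℝ} (hν : ν ≤ μ) (hf : Integrable f μ) (hf' : Integrable f' μ) :
    |∫ x, f x ∂ν - ∫ x, f' x ∂ν| ≤ ∫ x, ‖f x - f' x‖ ∂μ := by
  rw [← integral_sub (hf.mono_measure hν) (hf'.mono_measure hν)]
  exact abs_integral_le_integral_abs.trans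
    (integral_mono_measure hν (Eventually.of_forall fun _ => abs_nonneg _) (hf.sub hf').norm)

theorem NearlyCoupled.abs_integral_sub_le {X : Type*} [PseudoMetricSpace X] [MeasurableSpace X]
    {δ C : ℝ} {a b : Measure X} [IsFiniteMeasure a] {φ : X → ℝ} (hab : NearlyCoupled δ 0 a b)
    (hφa : Integrable φ a) (hφb : Integrable φ b)
    (hφ : ∀ x y, dist x y ≤ δ → |φ y - φ x| ≤ C) :
    |∫ x, φ x ∂b - ∫ x, φ x ∂a| ≤ C * a.real univ := by
  obtain ⟨p, rfl, rfl, hp⟩ := hab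
  have : IsFiniteMeasure p := isFiniteMeasure_of_fst
  have hφ₁ : Integrable (fun z => φ z.1) p := hφa.comp_measurable measurable_fst
  have hφ₂ : Integrable (fun z => φ z.2) p := hφb.comp_measurable measurable_snd
  have hle : ∀ᵐ z ∂p, ‖φ z.2 - φ z.1‖ ≤ C := by
    filter_upwards [measure_eq_zero_iff_ae_notMem.1 (nonpos_iff_eq_zero.1 hp)] with z hz
    exact hφ _ _ (not_lt.1 hz)
  rw [Measure.fst, Measure.snd, integral_map measurable_fst.aemeasurable hφa.aestronglyMeasurable,
    integral_map measurable_snd.aemeasurable hφb.aestronglyMeasurable,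
    ← integral_sub hφ₂ hφ₁, ← Measure.fst, Measure.real, Measure.fst_univ]
  exact norm_integral_le_of_norm_le_const hle

section Integrals

variable {X : Type*} [MetricSpace X] [MeasurableSpace X] {μ : Measure X} {h : ℝ → ℝ} {b : ℝ}
  [SecondCountableTopology X]

theorem integrable_of_mem_domMeasures {f : X → ℝ} (hf : LocallyIntegrable f μ)
    {ν : Measure X} (hν : ν ∈ DomMeasures μ) : Integrable f ν :=
  (show Integrable f (μ.restrict ν.support) from hf.integrableOn_isCompact hν.2).mono_measure
    (le_restrict_of_measure_compl_eq_zero hν.1 Measure.measure_compl_support)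

variable [BorelSpace X]

theorem Close.measure_compl_cthickening_eq_zero {δ r : ℝ} {ν η : Measure X} (hc : Close δ ν η)
    (hr : δ < r) : η (Metric.cthickening r ν.support)ᶜ = 0 := by
  obtain ⟨p, rfl, rfl, hp⟩ := hc r hr
  rw [Measure.snd_apply Metric.isClosed_cthickening.measurableSet.compl]
  have hsupp : p (Prod.fst ⁻¹' p.fst.supportᶜ) = 0 := by
    rw [← Measure.fst_apply Measure.isOpen_compl_support.measurableSet,
      Measure.measure_compl_support]
  refine measure_mono_null (fun z hz => ?_) (measure_union_null (nonpos_iff_eq_zero.1 hp) hsupp)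
  by_contra hcon
  simp only [mem_union, mem_ofPred_eq, mem_preimage, mem_compl_iff, not_or, not_lt,
    not_not] at hcon
  exact hz (Metric.mem_cthickening_of_dist_le _ _ _ _ hcon.2 (by rw [dist_comm]; exact hcon.1))

variable [LocallyCompactSpace X] [IsLocallyFiniteMeasure μ]

theorem exists_forall_close_abs_integral_sub_le {f : X → ℝ} (hf : LocallyIntegrable f μ)
    {η : Measure X} (hη : η ∈ DomMeasures μ) {τ : ℝ} (hτ : 0 < τ) :
    ∃ ε > 0, ∀ ζ ∈ DomMeasures μ, Close ε η ζ → |∫ x, f x ∂ζ - ∫ x, f x ∂η| ≤ τ := by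
  have := isFiniteMeasure_of_mem_domMeasures hη
  obtain ⟨r, hr, hK⟩ := hη.2.exists_isCompact_cthickening
  set K := Metric.cthickening r η.support
  have hfK : Integrable f (μ.restrict K) := hf.integrableOn_isCompact hK
  obtain ⟨φ, hφc, hφf, hφ, hφi⟩ :=
    hfK.exists_hasCompactSupport_integral_sub_le (show 0 < τ / 3 by linarith)
  have hmass : 0 < η.real univ + 1 := add_pos_of_nonneg_of_pos measureReal_nonneg one_pos
  obtain ⟨ρ, hρ, hφρ⟩ := Metric.uniformContinuous_iff.1
    (hφc.uniformContinuous_of_continuous hφ) (τ / 3 / (η.real univ + 1)) (by positivity)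
  have hmin : 0 < min r ρ := lt_min hr hρ
  refine ⟨min r ρ / 3, by linarith, fun ζ hζ hc => ?_⟩
  have hζK := le_restrict_of_measure_compl_eq_zero hζ.1
    (hc.measure_compl_cthickening_eq_zero (by linarith [min_le_left r ρ]) : ζ Kᶜ = 0)
  have hηK := le_restrict_of_measure_compl_eq_zero hη.1
    (measure_compl_eq_zero_of_le le_rfl (Metric.self_subset_cthickening _) : η Kᶜ = 0)
  have hfζ := (abs_integral_sub_integral_le_of_le hζK hfK hφi).trans hφf
  have hfη := (abs_integral_sub_integral_le_of_le hηK hfK hφi).trans hφf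
  have hφζη : |∫ x, φ x ∂ζ - ∫ x, φ x ∂η| ≤ τ / 3 := by
    refine ((hc (min r ρ / 2) (by linarith)).abs_integral_sub_le (C := τ / 3 / (η.real univ + 1))
      (hφi.mono_measure hηK) (hφi.mono_measure hζK) fun x y hxy => ?_).trans ?_
    · rw [dist_comm] at hxy
      exact (hφρ (by linarith [min_le_right r ρ])).le
    · rw [div_mul_eq_mul_div, div_le_iff₀ hmass]
      exact mul_le_mul_of_nonneg_left (by linarith) (by positivity)
  rw [abs_le] at *
  constructor <;> linarith

variable [StandardBorelSpace X] {ν : ℝ → NonzeroDom μ}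

theorem IsCurve.continuousOn_integral (hh : IsWeakGauge h) (hν : IsCurve μ h b ν) {f : X → ℝ}
    (hf : LocallyIntegrable f μ) : ContinuousOn (fun t => ∫ x, f x ∂(ν t).1) (Icc 0 b) := by
  intro t ht
  rw [ContinuousWithinAt, Metric.tendsto_nhdsWithin_nhds]
  intro τ hτ
  obtain ⟨ε, hε, H⟩ := exists_forall_close_abs_integral_sub_le hf (ν t).2.1 (half_pos hτ)
  refine ⟨ε, hε, fun s hs hst => ?_⟩
  rw [Real.dist_eq] at hst ⊢
  refine (H _ (ν s).2.1 ?_).trans_lt (half_lt_self hτ)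
  rcases le_total s t with hle | hle
  · exact (hν.close hh hs.1 hle ht.2).symm.mono (by linarith [neg_le_abs (s - t)])
  · exact (hν.close hh ht.1 hle hs.2).mono (by linarith [le_abs_self (s - t)])

theorem IsCurve.intervalIntegrable_integral (hh : IsWeakGauge h) (hν : IsCurve μ h b ν)
    {f : X → ℝ} (hf : LocallyIntegrable f μ) {s : ℝ} (hs : s ∈ Icc 0 b) :
    IntervalIntegrable (fun t => ∫ x, f x ∂(ν t).1) volume 0 s :=
  ((hν.continuousOn_integral hh hf).mono
    (Icc_subset_Icc_right hs.2)).intervalIntegrable_of_Icc hs.1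

end Integrals

theorem sub_le_integral_of_liminf_slope_right_le {φ G : ℝ → ℝ} {a b : ℝ}
    (hφ : ContinuousOn φ (Icc a b)) (hG : ContinuousOn G (Icc a b))
    (hφG : ∀ x ∈ Ico a b, ∀ r, G x < r → ∃ᶠ z in 𝓝[>] x, slope φ x z < r) {s : ℝ}
    (hs : s ∈ Icc a b) : φ s - φ a ≤ ∫ t in a..s, G t := by
  have hab : a ≤ b := hs.1.trans hs.2
  set G' : ℝ → ℝ := IccExtend hab ((Icc a b).domRestrict G)
  have hG' : Continuous G' := (continuousOn_iff_continuous_domRestrict.1 hG).Icc_extend'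
  have hGG : ∀ x ∈ Icc a b, G' x = G x := fun x hx => IccExtend_of_mem _ _ hx
  have hderiv : ∀ x, HasDerivAt (fun u => φ a + ∫ t in a..u, G' t) (G' x) x := fun x =>
    ((hG'.integral_hasStrictDerivAt a x).hasDerivAt).const_add _
  have hle := image_le_of_liminf_slope_right_le_deriv_boundary hφ (B' := G')
    (B := fun u => φ a + ∫ t in a..u, G' t) (by simp)
    (fun x _ => (hderiv x).continuousAt.continuousWithinAt)
    (fun x _ => (hderiv x).hasDerivWithinAt)
    (fun x hx r hr => hφG x hx r (by rwa [← hGG x ⟨hx.1, hx.2.le⟩])) hs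
  have hcongr : ∫ t in a..s, G' t = ∫ t in a..s, G t := by
    refine intervalIntegral.integral_congr fun t ht => ?_
    rw [uIcc_of_le hs.1] at ht
    exact hGG t ⟨ht.1, ht.2.trans hs.2⟩
  simp only [hcongr] at hle
  linarith

theorem sub_le_integral_of_eventually_sub_le_mul {φ G : ℝ → ℝ} {a b : ℝ}
    (hφ : ContinuousOn φ (Icc a b)) (hG : ContinuousOn G (Icc a b))
    (hφG : ∀ x ∈ Ico a b, ∀ r, G x < r → ∀ᶠ s in 𝓝[>] 0, φ (x + s) - φ x ≤ r * s) {s : ℝ}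
    (hs : s ∈ Icc a b) : φ s - φ a ≤ ∫ t in a..s, G t := by
  refine sub_le_integral_of_liminf_slope_right_le hφ hG (fun x hx r hr => ?_) hs
  obtain ⟨r', hr', hr'r⟩ := exists_between hr
  have hev : ∀ᶠ z in 𝓝[>] x, φ (x + (z - x)) - φ x ≤ r' * (z - x) := by
    have h0 : map (fun z => z - x) (𝓝[>] x) = 𝓝[>] 0 := by simp [map_subRight_nhdsGT]
    exact eventually_map.1 (h0 ▸ hφG x hx r' hr')
  refine Eventually.frequently ?_
  filter_upwards [hev, self_mem_nhdsWithin] with z hz hxz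
  rw [slope_def_field, div_lt_iff₀ (sub_pos.2 hxz)]
  rw [add_sub_cancel] at hz
  exact hz.trans_lt (mul_lt_mul_of_pos_right hr'r (sub_pos.2 hxz))

/-! ### Slopes and bounds along curves -/

section Bounds

variable {X : Type*} [MetricSpace X] [MeasurableSpace X] {μ : Measure X} {h : ℝ → ℝ} {b : ℝ}
  {f f' g g' : X → ℝ}

theorem ofReal_abs_sub_div_le_curveSlopeAt (F : NonzeroDom μ → ℝ) {ν : ℝ → NonzeroDom μ}
    (hν : IsCurve μ h b ν) {ε s : ℝ} (hs : s ∈ Ioo 0 (min ε b)) :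
    ENNReal.ofReal (|F (ν s) - F (ν 0)| / s) ≤ curveSlopeAt μ h F ε (ν 0) :=
  le_iSup_of_le b <| le_iSup_of_le ν <| le_iSup_of_le hν <| le_iSup_of_le rfl <|
    le_iSup_of_le s <| le_iSup_of_le hs le_rfl

theorem curveSlopeAt_le {F : NonzeroDom μ → ℝ} {η : NonzeroDom μ} {ε : ℝ} {C : ℝ≥0∞}
    (H : ∀ (b : ℝ) (ν : ℝ → NonzeroDom μ), IsCurve μ h b ν → ν 0 = η → ∀ s ∈ Ioo 0 (min ε b),
      ENNReal.ofReal (|F (ν s) - F η| / s) ≤ C) : curveSlopeAt μ h F ε η ≤ C :=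
  iSup_le fun b => iSup_le fun ν => iSup_le fun hν => iSup_le fun h0 =>
    iSup_le fun s => iSup_le fun hs => H b ν hν h0 s hs

theorem curveSlopeAt_mono (F : NonzeroDom μ → ℝ) (η : NonzeroDom μ) :
    Monotone fun ε => curveSlopeAt μ h F ε η := fun ε ε' hε => by
  refine curveSlopeAt_le fun b ν hν h0 s hs => ?_
  subst h0
  exact ofReal_abs_sub_div_le_curveSlopeAt F hν ⟨hs.1, hs.2.trans_le (min_le_min_right b hε)⟩

theorem tendsto_curveSlopeAt (F : NonzeroDom μ → ℝ) (η : NonzeroDom μ) :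
    Tendsto (fun ε => curveSlopeAt μ h F ε η) (𝓝[>] 0) (𝓝 (curveSlope μ h F η)) := by
  have := (curveSlopeAt_mono (h := h) F η).tendsto_nhdsGT 0
  rwa [sInf_image] at this

theorem curveSlope_le_add {F F₁ F₂ : NonzeroDom μ → ℝ} {η : NonzeroDom μ}
    (hF : ∀ ζ, |F ζ - F η| ≤ |F₁ ζ - F₁ η| + |F₂ ζ - F₂ η|) :
    curveSlope μ h F η ≤ curveSlope μ h F₁ η + curveSlope μ h F₂ η := by
  refine le_of_tendsto_of_tendsto' (tendsto_curveSlopeAt F η)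
    ((tendsto_curveSlopeAt F₁ η).add (tendsto_curveSlopeAt F₂ η)) fun ε =>
    curveSlopeAt_le fun b ν hν h0 s hs => ?_
  subst h0
  have hs0 : 0 < s := hs.1
  calc ENNReal.ofReal (|F (ν s) - F (ν 0)| / s)
      ≤ ENNReal.ofReal (|F₁ (ν s) - F₁ (ν 0)| / s + |F₂ (ν s) - F₂ (ν 0)| / s) := by
        rw [← add_div]
        exact ENNReal.ofReal_le_ofReal (div_le_div_of_nonneg_right (hF _) hs0.le)
    _ = ENNReal.ofReal (|F₁ (ν s) - F₁ (ν 0)| / s) + ENNReal.ofReal (|F₂ (ν s) - F₂ (ν 0)| / s) :=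
        ENNReal.ofReal_add (by positivity) (by positivity)
    _ ≤ _ := add_le_add (ofReal_abs_sub_div_le_curveSlopeAt F₁ hν hs)
        (ofReal_abs_sub_div_le_curveSlopeAt F₂ hν hs)

theorem meanValue_sub_of_mass_eq {η ζ : NonzeroDom μ} (hm : ζ.1.real univ = η.1.real univ) :
    meanValue μ f ζ - meanValue μ f η =
      (η.1.real univ)⁻¹ * (∫ x, f x ∂ζ.1 - ∫ x, f x ∂η.1) := by
  rw [meanValue, meanValue, hm, mul_sub]

theorem IsUpperGradient.congr_grad (H : IsUpperGradient μ h f g) (hg : g =ᵐ[μ] g') :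
    IsUpperGradient μ h f g' where
  locallyIntegrable := H.locallyIntegrable
  locallyIntegrable_grad := H.locallyIntegrable_grad.congr hg
  slope_eq η := by rw [H.slope_eq η, meanValue, meanValue, integral_congr_of_le η.2.1.1 hg]

theorem IsUpperGradient.meanValue_nonneg (H : IsUpperGradient μ h f g) (η : NonzeroDom μ) :
    0 ≤ meanValue μ g η :=
  EReal.coe_nonneg.1 (H.slope_eq η ▸ EReal.coe_ennreal_nonneg _)

theorem IsUpperGradient.curveSlope_eq (H : IsUpperGradient μ h f g) (η : NonzeroDom μ) :
    curveSlope μ h (meanValue μ f) η = ENNReal.ofReal (meanValue μ g η) := by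
  rw [← EReal.coe_ennreal_eq_coe_ennreal_iff, H.slope_eq η, EReal.coe_ennreal_ofReal,
    max_eq_left (H.meanValue_nonneg η)]

theorem BoundsAlongCurves.congr (H : BoundsAlongCurves μ h f g) (hf : f =ᵐ[μ] f')
    (hg : g =ᵐ[μ] g') : BoundsAlongCurves μ h f' g' where
  locallyIntegrable := H.locallyIntegrable.congr hf
  locallyIntegrable_grad := H.locallyIntegrable_grad.congr hg
  nonneg := H.nonneg.trans_eq hg
  bound b ν hν s hs hsb := by
    simpa only [fun t => integral_congr_of_le (ν t).2.1.1 hf,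
      fun t => integral_congr_of_le (ν t).2.1.1 hg] using H.bound b ν hν s hs hsb

theorem BoundsAlongCurves.neg (H : BoundsAlongCurves μ h f g) :
    BoundsAlongCurves μ h (fun x => -f x) g where
  locallyIntegrable := H.locallyIntegrable.neg
  locallyIntegrable_grad := H.locallyIntegrable_grad
  nonneg := H.nonneg
  bound b ν hν s hs hsb := by
    simpa only [integral_neg, neg_sub_neg, abs_sub_comm] using H.bound b ν hν s hs hsb

theorem BoundsAlongCurves.meanValue_nonneg (H : BoundsAlongCurves μ h f g) (η : NonzeroDom μ) :
    0 ≤ meanValue μ g η :=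
  mul_nonneg (inv_nonneg.2 measureReal_nonneg)
    (integral_nonneg_of_ae (Measure.absolutelyContinuous_of_le η.2.1.1 H.nonneg))

theorem ae_le_of_forall_integral_le [SecondCountableTopology X] [BorelSpace X]
    [LocallyCompactSpace X] (hf : LocallyIntegrable f μ) (hg : LocallyIntegrable g μ)
    (H : ∀ η : NonzeroDom μ, ∫ x, f x ∂η.1 ≤ ∫ x, g x ∂η.1) : f ≤ᵐ[μ] g := by
  have hcov : ∀ᵐ x ∂μ.restrict (⋃ n, compactCovering X n), f x ≤ g x := by
    rw [ae_restrict_iUnion_iff]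
    intro n
    have hK := isCompact_compactCovering X n
    refine ae_le_of_forall_setIntegral_le (hf.integrableOn_isCompact hK)
      (hg.integrableOn_isCompact hK) fun s hs _ => ?_
    rw [Measure.restrict_restrict hs]
    by_cases h0 : μ.restrict (s ∩ compactCovering X n) = 0
    · simp only [h0, integral_zero_measure, le_refl]
    · refine H ⟨_, ⟨Measure.restrict_le_self, hK.of_isClosed_subset Measure.isClosed_support ?_⟩,
        h0⟩
      refine Measure.support_subset_of_isClosed hK.isClosed ?_
      rw [mem_ae_iff, Measure.restrict_apply hK.isClosed.measurableSet.compl]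
      exact measure_mono_null (t := ∅) (fun x hx => hx.1 hx.2.2) measure_empty
  rwa [iUnion_compactCovering, Measure.restrict_univ] at hcov

theorem ae_eq_of_forall_integral_eq [SecondCountableTopology X] [BorelSpace X]
    [LocallyCompactSpace X] (hf : LocallyIntegrable f μ) (hg : LocallyIntegrable g μ)
    (H : ∀ η : NonzeroDom μ, ∫ x, f x ∂η.1 = ∫ x, g x ∂η.1) : f =ᵐ[μ] g :=
  (ae_le_of_forall_integral_le hf hg fun η => (H η).le).antisymm
    (ae_le_of_forall_integral_le hg hf fun η => (H η).ge)

theorem isSmallestBound_iff_ae_eq (H : IsSmallestBound μ h f g) :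
    IsSmallestBound μ h f g' ↔ g' =ᵐ[μ] g where
  mp H' := (H'.le g H.bounds).antisymm (H.le g' H'.bounds)
  mpr hg := ⟨H.bounds.congr (ae_eq_refl f) hg.symm, fun u hu => hg.le.trans (H.le u hu)⟩

theorem IsSmallestBound.neg (H : IsSmallestBound μ h f g) :
    IsSmallestBound μ h (fun x => -f x) g :=
  ⟨H.bounds.neg, fun u hu => H.le u (by simpa only [neg_neg] using hu.neg)⟩

variable [SecondCountableTopology X]

theorem BoundsAlongCurves.add_const [IsLocallyFiniteMeasure μ] (hh : IsWeakGauge h)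
    (H : BoundsAlongCurves μ h f g) (c : ℝ) : BoundsAlongCurves μ h (fun x => f x + c) g where
  locallyIntegrable := H.locallyIntegrable.add (locallyIntegrable_const c)
  locallyIntegrable_grad := H.locallyIntegrable_grad
  nonneg := H.nonneg
  bound b ν hν s hs hsb := by
    have hadd : ∀ t, ∫ x, f x + c ∂(ν t).1 = ∫ x, f x ∂(ν t).1 + (ν t).1.real univ * c :=
      fun t => by
        rw [integral_add (integrable_of_mem_domMeasures H.locallyIntegrable (ν t).2.1)
          (integrable_const c), integral_const, smul_eq_mul]
    rw [hadd, hadd, hν.mass_eq hh ⟨hs, hsb⟩, add_sub_add_right_eq_sub]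
    exact H.bound b ν hν s hs hsb

theorem meanValue_add (hf : LocallyIntegrable f μ) (hf' : LocallyIntegrable f' μ)
    (η : NonzeroDom μ) :
    meanValue μ (fun x => f x + f' x) η = meanValue μ f η + meanValue μ f' η := by
  rw [meanValue, integral_add (integrable_of_mem_domMeasures hf η.2.1)
    (integrable_of_mem_domMeasures hf' η.2.1), mul_add, meanValue, meanValue]

theorem meanValue_mono (hg : LocallyIntegrable g μ) (hg' : LocallyIntegrable g' μ)
    (hle : g ≤ᵐ[μ] g') (η : NonzeroDom μ) : meanValue μ g η ≤ meanValue μ g' η :=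
  mul_le_mul_of_nonneg_left
    (integral_mono_ae (integrable_of_mem_domMeasures hg η.2.1)
      (integrable_of_mem_domMeasures hg' η.2.1)
      (Measure.absolutelyContinuous_of_le η.2.1.1 hle))
    (inv_nonneg.2 measureReal_nonneg)

variable [IsLocallyFiniteMeasure μ]

theorem meanValue_const (c : ℝ) (η : NonzeroDom μ) : meanValue μ (fun _ => c) η = c := by
  rw [meanValue, integral_const, smul_eq_mul, inv_mul_cancel_left₀ η.mass_pos.ne']

theorem IsUpperGradient.add_const (H : IsUpperGradient μ h f g) (c : ℝ) :
    IsUpperGradient μ h (fun x => f x + c) g where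
  locallyIntegrable := H.locallyIntegrable.add (locallyIntegrable_const c)
  locallyIntegrable_grad := H.locallyIntegrable_grad
  slope_eq η := by
    have hmean : ∀ ζ, meanValue μ (fun x => f x + c) ζ = meanValue μ f ζ + c := fun ζ => by
      rw [meanValue_add H.locallyIntegrable (locallyIntegrable_const c), meanValue_const]
    simpa only [curveSlope, curveSlopeAt, hmean, add_sub_add_right_eq_sub] using H.slope_eq η

variable [BorelSpace X] [LocallyCompactSpace X]

theorem IsUpperGradient.nonneg (H : IsUpperGradient μ h f g) : 0 ≤ᵐ[μ] g := by
  refine ae_le_of_forall_integral_le (locallyIntegrable_const 0) H.locallyIntegrable_grad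
    fun η => ?_
  simpa only [Pi.zero_apply, integral_zero] using
    (mul_nonneg_iff_of_pos_left (inv_pos.2 η.mass_pos)).1 (H.meanValue_nonneg η)

theorem IsUpperGradient.ae_eq (H : IsUpperGradient μ h f g) (H' : IsUpperGradient μ h f g') :
    g =ᵐ[μ] g' := by
  refine ae_eq_of_forall_integral_eq H.locallyIntegrable_grad H'.locallyIntegrable_grad
    fun η => ?_
  have hmean : meanValue μ g η = meanValue μ g' η :=
    EReal.coe_eq_coe_iff.1 ((H.slope_eq η).symm.trans (H'.slope_eq η))
  exact mul_left_cancel₀ (inv_ne_zero η.mass_pos.ne') hmean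

theorem isUpperGradient_iff_ae_eq (H : IsUpperGradient μ h f g) :
    IsUpperGradient μ h f g' ↔ g' =ᵐ[μ] g :=
  ⟨fun H' => H'.ae_eq H, fun hg => H.congr_grad hg.symm⟩

variable [StandardBorelSpace X]

theorem boundsAlongCurves_of_eventually_le (hh : IsWeakGauge h) (hf : LocallyIntegrable f μ)
    (hg : LocallyIntegrable g μ) (hg0 : 0 ≤ᵐ[μ] g)
    (H : ∀ (b : ℝ) (ν : ℝ → NonzeroDom μ), IsCurve μ h b ν → 0 < b → ∀ r, ∫ x, g x ∂(ν 0).1 < r →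
      ∀ᶠ s in 𝓝[>] 0, ∫ x, f x ∂(ν s).1 - ∫ x, f x ∂(ν 0).1 ≤ r * s) :
    BoundsAlongCurves μ h f g := by
  have hforward : ∀ (b : ℝ) (ν : ℝ → NonzeroDom μ), IsCurve μ h b ν → ∀ s ∈ Icc 0 b,
      ∫ x, f x ∂(ν s).1 - ∫ x, f x ∂(ν 0).1 ≤ ∫ t in (0 : ℝ)..s, ∫ x, g x ∂(ν t).1 := by
    intro b ν hν s hs
    refine sub_le_integral_of_eventually_sub_le_mul (φ := fun t => ∫ x, f x ∂(ν t).1)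
      (hν.continuousOn_integral hh hf) (hν.continuousOn_integral hh hg) (fun t ht r hr => ?_) hs
    simpa only [add_zero] using H (b - t) _ (hν.shift (Ico_subset_Icc_self ht)) (sub_pos.2 ht.2) r
      (by simpa only [add_zero] using hr)
  refine ⟨hf, hg, hg0, fun b ν hν s hs hsb => abs_le.2 ⟨?_, hforward b ν hν s ⟨hs, hsb⟩⟩⟩
  have hbackward := hforward s _ (hν.reverse ⟨hs, hsb⟩) s ⟨hs, le_rfl⟩
  rw [intervalIntegral.integral_comp_sub_left (fun t => ∫ x, g x ∂(ν t).1) s] at hbackward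
  simp only [sub_self, sub_zero] at hbackward
  linarith

theorem IsUpperGradient.boundsAlongCurves (hh : IsWeakGauge h) (H : IsUpperGradient μ h f g) :
    BoundsAlongCurves μ h f g := by
  refine boundsAlongCurves_of_eventually_le hh H.locallyIntegrable H.locallyIntegrable_grad
    H.nonneg fun b ν hν hb r hr => ?_
  have hm : 0 < ((ν 0).1.real univ)⁻¹ := inv_pos.2 (ν 0).mass_pos
  have hgr : meanValue μ g (ν 0) < ((ν 0).1.real univ)⁻¹ * r := mul_lt_mul_of_pos_left hr hm
  have hpos := (H.meanValue_nonneg _).trans_lt hgr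
  have hslope : curveSlope μ h (meanValue μ f) (ν 0) <
      ENNReal.ofReal (((ν 0).1.real univ)⁻¹ * r) := by
    rw [H.curveSlope_eq]
    exact (ENNReal.ofReal_lt_ofReal_iff hpos).2 hgr
  obtain ⟨ε, hε, hε0⟩ :=
    (((tendsto_curveSlopeAt _ _).eventually_lt_const hslope).and self_mem_nhdsWithin).exists
  filter_upwards [Ioo_mem_nhdsGT (lt_min hε0 hb)] with s hs
  have hlt := (ofReal_abs_sub_div_le_curveSlopeAt (meanValue μ f) hν hs).trans_lt hε
  rw [ENNReal.ofReal_lt_ofReal_iff hpos, div_lt_iff₀ hs.1,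
    meanValue_sub_of_mass_eq (hν.mass_eq hh ⟨hs.1.le, hs.2.le.trans (min_le_right _ _)⟩), abs_mul,
    abs_of_pos hm, mul_assoc] at hlt
  exact (le_abs_self _).trans (lt_of_mul_lt_mul_left hlt hm.le).le

theorem BoundsAlongCurves.exists_abs_integral_sub_le (hh : IsWeakGauge h)
    (H : BoundsAlongCurves μ h f g) (η : NonzeroDom μ) {r : ℝ} (hr : ∫ x, g x ∂η.1 < r) :
    ∃ ε > 0, ∀ (b : ℝ) (ν : ℝ → NonzeroDom μ), IsCurve μ h b ν → ν 0 = η →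
      ∀ s ∈ Ioo 0 (min ε b), |∫ x, f x ∂(ν s).1 - ∫ x, f x ∂η.1| ≤ r * s := by
  obtain ⟨ε, hε, hclose⟩ :=
    exists_forall_close_abs_integral_sub_le H.locallyIntegrable_grad η.2.1 (sub_pos.2 hr)
  refine ⟨ε, hε, fun b ν hν h0 s hs => ?_⟩
  subst h0
  obtain ⟨hsε, hsb⟩ := lt_min_iff.1 hs.2
  have hle : ∀ t ∈ Icc 0 s, ∫ x, g x ∂(ν t).1 ≤ r := by
    intro t ht
    have hc : Close ε (ν 0).1 (ν t).1 :=
      (hν.close hh le_rfl ht.1 (ht.2.trans hsb.le)).mono (by linarith [ht.2])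
    linarith [(abs_le.1 (hclose _ (ν t).2.1 hc)).2]
  calc |∫ x, f x ∂(ν s).1 - ∫ x, f x ∂(ν 0).1|
      ≤ ∫ t in (0 : ℝ)..s, ∫ x, g x ∂(ν t).1 := H.bound b ν hν s hs.1.le hsb.le
    _ ≤ ∫ _ in (0 : ℝ)..s, r := intervalIntegral.integral_mono_on hs.1.le
        (hν.intervalIntegrable_integral hh H.locallyIntegrable_grad ⟨hs.1.le, hsb.le⟩)
        intervalIntegrable_const hle
    _ = r * s := by rw [intervalIntegral.integral_const, sub_zero, smul_eq_mul, mul_comm]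

theorem BoundsAlongCurves.curveSlope_le (hh : IsWeakGauge h) (H : BoundsAlongCurves μ h f g)
    (η : NonzeroDom μ) : curveSlope μ h (meanValue μ f) η ≤ ENNReal.ofReal (meanValue μ g η) := by
  have hm : 0 < (η.1.real univ)⁻¹ := inv_pos.2 η.mass_pos
  have hlim : Tendsto (fun r : ℝ => ENNReal.ofReal ((η.1.real univ)⁻¹ * r))
      (𝓝[>] ∫ x, g x ∂η.1) (𝓝 (ENNReal.ofReal (meanValue μ g η))) :=
    ((ENNReal.continuous_ofReal.comp (continuous_const_mul _)).tendsto _).mono_left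
      nhdsWithin_le_nhds
  refine ge_of_tendsto hlim ?_
  filter_upwards [self_mem_nhdsWithin] with r hr
  obtain ⟨ε, hε, hb⟩ := H.exists_abs_integral_sub_le hh η hr
  refine (iInf₂_le ε hε).trans (curveSlopeAt_le fun b ν hν h0 s hs => ?_)
  refine ENNReal.ofReal_le_ofReal ((div_le_iff₀ hs.1).2 ?_)
  have hmass : (ν s).1.real univ = η.1.real univ :=
    h0 ▸ hν.mass_eq hh ⟨hs.1.le, hs.2.le.trans (min_le_right _ _)⟩
  rw [meanValue_sub_of_mass_eq hmass, abs_mul, abs_of_pos hm, mul_assoc]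
  exact mul_le_mul_of_nonneg_left (hb b ν hν h0 s hs) hm.le

theorem BoundsAlongCurves.add (hh : IsWeakGauge h) (H : BoundsAlongCurves μ h f g)
    (H' : BoundsAlongCurves μ h f' g') :
    BoundsAlongCurves μ h (fun x => f x + f' x) fun x => g x + g' x where
  locallyIntegrable := H.locallyIntegrable.add H'.locallyIntegrable
  locallyIntegrable_grad := H.locallyIntegrable_grad.add H'.locallyIntegrable_grad
  nonneg := by
    filter_upwards [H.nonneg, H'.nonneg] with x hx hx'
    exact add_nonneg hx hx'
  bound b ν hν s hs hsb := by
    have hadd : ∀ {u v : X → ℝ}, LocallyIntegrable u μ → LocallyIntegrable v μ → ∀ t,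
        ∫ x, u x + v x ∂(ν t).1 = ∫ x, u x ∂(ν t).1 + ∫ x, v x ∂(ν t).1 := fun hu hv t =>
      integral_add (integrable_of_mem_domMeasures hu (ν t).2.1)
        (integrable_of_mem_domMeasures hv (ν t).2.1)
    simp_rw [hadd H.locallyIntegrable H'.locallyIntegrable,
      hadd H.locallyIntegrable_grad H'.locallyIntegrable_grad]
    rw [intervalIntegral.integral_add
      (hν.intervalIntegrable_integral hh H.locallyIntegrable_grad ⟨hs, hsb⟩)
      (hν.intervalIntegrable_integral hh H'.locallyIntegrable_grad ⟨hs, hsb⟩), add_sub_add_comm]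
    exact (abs_add_le _ _).trans (add_le_add (H.bound b ν hν s hs hsb) (H'.bound b ν hν s hs hsb))

theorem BoundsAlongCurves.isUpperGradient (hh : IsWeakGauge h) (H : BoundsAlongCurves μ h f g)
    (hle : ∀ η, ENNReal.ofReal (meanValue μ g η) ≤ curveSlope μ h (meanValue μ f) η) :
    IsUpperGradient μ h f g where
  locallyIntegrable := H.locallyIntegrable
  locallyIntegrable_grad := H.locallyIntegrable_grad
  slope_eq η := by
    rw [(H.curveSlope_le hh η).antisymm (hle η), EReal.coe_ennreal_ofReal,
      max_eq_left (H.meanValue_nonneg η)]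

theorem IsUpperGradient.of_add {u : X → ℝ} (hh : IsWeakGauge h)
    (H : IsUpperGradient μ h (fun x => f x + f' x) u) (Hf : BoundsAlongCurves μ h f g)
    (Hf' : BoundsAlongCurves μ h f' g') (hle : (fun x => g x + g' x) ≤ᵐ[μ] u) :
    IsUpperGradient μ h f g := by
  refine Hf.isUpperGradient hh fun η => ?_
  have hsum : ENNReal.ofReal (meanValue μ g η) + ENNReal.ofReal (meanValue μ g' η) ≤
      curveSlope μ h (meanValue μ f) η + ENNReal.ofReal (meanValue μ g' η) :=
    calc ENNReal.ofReal (meanValue μ g η) + ENNReal.ofReal (meanValue μ g' η)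
        = ENNReal.ofReal (meanValue μ (fun x => g x + g' x) η) := by
          rw [meanValue_add Hf.locallyIntegrable_grad Hf'.locallyIntegrable_grad,
            ENNReal.ofReal_add (Hf.meanValue_nonneg η) (Hf'.meanValue_nonneg η)]
      _ ≤ ENNReal.ofReal (meanValue μ u η) := ENNReal.ofReal_le_ofReal <| meanValue_mono
          (Hf.add hh Hf').locallyIntegrable_grad H.locallyIntegrable_grad hle η
      _ = curveSlope μ h (meanValue μ fun x => f x + f' x) η := (H.curveSlope_eq η).symm
      _ ≤ curveSlope μ h (meanValue μ f) η + curveSlope μ h (meanValue μ f') η := by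
          refine curveSlope_le_add fun ζ => ?_
          rw [meanValue_add Hf.locallyIntegrable Hf'.locallyIntegrable,
            meanValue_add Hf.locallyIntegrable Hf'.locallyIntegrable, add_sub_add_comm]
          exact abs_add_le _ _
      _ ≤ curveSlope μ h (meanValue μ f) η + ENNReal.ofReal (meanValue μ g' η) := by
          gcongr
          exact Hf'.curveSlope_le hh η
  exact (ENNReal.add_le_add_iff_right ENNReal.ofReal_ne_top).1 hsum

end Bounds

/-! ### Truncation -/

section IntegralMin

variable {X : Type*} [MeasurableSpace X] {k : X → ℝ} {ν : Measure X} [IsFiniteMeasure ν] {c : ℝ}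

theorem integral_min_le_of_le {a : Measure X} (ha : a ≤ ν) (hk : Integrable k ν) :
    ∫ x, min (k x) c ∂ν ≤ ∫ x, k x ∂a + c * (ν.real univ - a.real univ) := by
  have : IsFiniteMeasure a := isFiniteMeasure_of_le _ ha
  have hsub : ν - a + a = ν := Measure.sub_add_cancel_of_le ha
  have hle : ν - a ≤ ν := Measure.sub_le
  have : IsFiniteMeasure (ν - a) := isFiniteMeasure_of_le _ hle
  have hmin : Integrable (fun x => min (k x) c) ν := hk.inf (integrable_const c)
  have hmass : (ν - a).real univ = ν.real univ - a.real univ := by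
    rw [eq_sub_iff_add_eq, ← measureReal_add_apply, hsub]
  calc ∫ x, min (k x) c ∂ν
      = ∫ x, min (k x) c ∂a + ∫ x, min (k x) c ∂(ν - a) := by
        rw [add_comm, ← integral_add_measure (hmin.mono_measure hle) (hmin.mono_measure ha), hsub]
    _ ≤ ∫ x, k x ∂a + ∫ _, c ∂(ν - a) := add_le_add
        (integral_mono (hmin.mono_measure ha) (hk.mono_measure ha) fun _ => min_le_left _ _)
        (integral_mono (hmin.mono_measure hle) (integrable_const c) fun _ => min_le_right _ _)
    _ = ∫ x, k x ∂a + c * (ν.real univ - a.real univ) := by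
        rw [integral_const, hmass, smul_eq_mul, mul_comm c]

theorem integral_min_eq (hk : Integrable k ν) (hS : MeasurableSet {x | k x < c}) :
    ∫ x, min (k x) c ∂ν = ∫ x, k x ∂ν.restrict {x | k x < c} +
      c * (ν.real univ - (ν.restrict {x | k x < c}).real univ) := by
  have hmin : Integrable (fun x => min (k x) c) ν := hk.inf (integrable_const c)
  have hlt : ∫ x in {x | k x < c}, min (k x) c ∂ν = ∫ x in {x | k x < c}, k x ∂ν :=
    setIntegral_congr_fun hS fun x hx => min_eq_left (le_of_lt hx)
  have hge : ∫ x in {x | k x < c}ᶜ, min (k x) c ∂ν = ∫ _ in {x | k x < c}ᶜ, c ∂ν :=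
    setIntegral_congr_fun hS.compl fun x hx => min_eq_right (not_lt.1 hx)
  rw [← integral_add_compl hS hmin, hlt, hge, setIntegral_const, smul_eq_mul, mul_comm,
    measureReal_compl hS, measureReal_restrict_apply MeasurableSet.univ, univ_inter]

theorem integral_min_sub_integral_min_le {a η : Measure X} [IsFiniteMeasure η]
    (hkν : Integrable k ν) (hkη : Integrable k η) (hS : MeasurableSet {x | k x < c}) (ha : a ≤ η)
    (hη : η.real univ = ν.real univ) (haν : a.real univ = (ν.restrict {x | k x < c}).real univ) :
    ∫ x, min (k x) c ∂η - ∫ x, min (k x) c ∂ν ≤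
      ∫ x, k x ∂a - ∫ x, k x ∂ν.restrict {x | k x < c} := by
  have hle := integral_min_le_of_le (c := c) ha hkη
  rw [hη, haν] at hle
  rw [integral_min_eq hkν hS]
  linarith

end IntegralMin

theorem indicator_lt_add_indicator_gt_le {X : Type*} {k g : X → ℝ} (c : ℝ) {x : X}
    (hx : 0 ≤ g x) :
    {x | k x < c}.indicator g x + {x | c < k x}.indicator g x ≤ g x := by
  rcases lt_trichotomy (k x) c with hlt | heq | hgt
  · simp [indicator, hlt, hlt.not_gt]
  · simpa [indicator, heq] using hx
  · simp [indicator, hgt, hgt.not_gt]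

section Truncation

variable {X : Type*} [MetricSpace X] [MeasurableSpace X] {μ : Measure X} {h : ℝ → ℝ}
  {k g : X → ℝ}

theorem locallyIntegrable_min [IsLocallyFiniteMeasure μ] (hk : LocallyIntegrable k μ) (c : ℝ) :
    LocallyIntegrable (fun x => min (k x) c) μ := by
  intro x
  obtain ⟨s, hs, hks⟩ := hk x
  obtain ⟨t, ht, hct⟩ := locallyIntegrable_const (μ := μ) c x
  exact ⟨s ∩ t, inter_mem hs ht, (hks.mono_set inter_subset_left).inf
    (hct.mono_set inter_subset_right)⟩

variable [SecondCountableTopology X] [BorelSpace X] [LocallyCompactSpace X]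
  [IsLocallyFiniteMeasure μ] [StandardBorelSpace X]

theorem BoundsAlongCurves.min_const_of_measurable (hh : IsWeakGauge h)
    (H : BoundsAlongCurves μ h k g) (hk : Measurable k) (c : ℝ) :
    BoundsAlongCurves μ h (fun x => min (k x) c) ({x | k x < c}.indicator g) := by
  have hS : MeasurableSet {x | k x < c} := measurableSet_lt hk measurable_const
  have hki : ∀ η : NonzeroDom μ, Integrable k η.1 := fun η =>
    integrable_of_mem_domMeasures H.locallyIntegrable η.2.1
  refine boundsAlongCurves_of_eventually_le hh (locallyIntegrable_min H.locallyIntegrable c)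
    (H.locallyIntegrable_grad.indicator hS) ?_ fun b ν hν hb r hr => ?_
  · filter_upwards [H.nonneg] with x hx
    exact indicator_apply_nonneg fun _ => hx
  rw [integral_indicator hS] at hr
  have hmass : ∀ s ∈ Ioo 0 b, (ν s).1.real univ = (ν 0).1.real univ := fun s hs =>
    hν.mass_eq hh (Ioo_subset_Icc_self hs)
  by_cases hzero : (ν 0).1.restrict {x | k x < c} = 0
  · rw [hzero, integral_zero_measure] at hr
    filter_upwards [Ioo_mem_nhdsGT hb] with s hs
    have hmin := integral_min_sub_integral_min_le (hki (ν 0)) (hki (ν s)) hS (Measure.zero_le _)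
      (hmass s hs) (by rw [hzero])
    rw [hzero, sub_self] at hmin
    exact hmin.trans (mul_pos hr hs.1).le
  · obtain ⟨a, ha, ha0, hale⟩ := hν.exists_split hh Measure.restrict_le_self hzero
    rw [← ha0] at hr
    obtain ⟨ε, hε, hbound⟩ := H.exists_abs_integral_sub_le hh (a 0) hr
    filter_upwards [Ioo_mem_nhdsGT (lt_min hε hb)] with s hs
    have hsb : s ∈ Ioo 0 b := ⟨hs.1, hs.2.trans_le (min_le_right _ _)⟩
    have hmin := integral_min_sub_integral_min_le (hki (ν 0)) (hki (ν s)) hS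
      (hale s (Ioo_subset_Icc_self hsb)) (hmass s hsb)
      (ha0 ▸ ha.mass_eq hh (Ioo_subset_Icc_self hsb))
    rw [← ha0] at hmin
    exact (hmin.trans (le_abs_self _)).trans (hbound b a ha rfl s hs)

theorem BoundsAlongCurves.min_const (hh : IsWeakGauge h) (H : BoundsAlongCurves μ h k g) (c : ℝ) :
    BoundsAlongCurves μ h (fun x => min (k x) c) ({x | k x < c}.indicator g) := by
  obtain ⟨k', hk', hkk⟩ := H.locallyIntegrable.aestronglyMeasurable
  refine ((H.congr hkk (ae_eq_refl g)).min_const_of_measurable hh hk'.measurable c).congr ?_ ?_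
  · filter_upwards [hkk] with x hx
    rw [hx]
  · filter_upwards [hkk] with x hx
    simp only [indicator, mem_ofPred_eq, hx]

theorem BoundsAlongCurves.max_const (hh : IsWeakGauge h) (H : BoundsAlongCurves μ h k g) (c : ℝ) :
    BoundsAlongCurves μ h (fun x => max (k x) c) ({x | c < k x}.indicator g) := by
  simpa only [min_neg_neg, neg_neg, neg_lt_neg_iff] using (H.neg.min_const hh (-c)).neg

theorem BoundsAlongCurves.of_min_of_max (hh : IsWeakGauge h) {c : ℝ} {u v : X → ℝ}
    (Hu : BoundsAlongCurves μ h (fun x => min (k x) c) u)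
    (Hv : BoundsAlongCurves μ h (fun x => max (k x) c) v) :
    BoundsAlongCurves μ h k fun x => u x + v x := by
  simpa only [min_add_max, add_neg_cancel_right] using (Hu.add hh Hv).add_const hh (-c)

theorem IsUpperGradient.min_const (hh : IsWeakGauge h) (H : IsUpperGradient μ h k g) (c : ℝ) :
    IsUpperGradient μ h (fun x => min (k x) c) ({x | k x < c}.indicator g) := by
  have hB := H.boundsAlongCurves hh
  have hsum : IsUpperGradient μ h (fun x => min (k x) c + max (k x) c) g := by
    simpa only [min_add_max] using H.add_const c
  refine hsum.of_add hh (hB.min_const hh c) (hB.max_const hh c) ?_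
  filter_upwards [H.nonneg] with x hx using indicator_lt_add_indicator_gt_le c hx

theorem IsUpperGradient.max_const (hh : IsWeakGauge h) (H : IsUpperGradient μ h k g) (c : ℝ) :
    IsUpperGradient μ h (fun x => max (k x) c) ({x | c < k x}.indicator g) := by
  have hB := H.boundsAlongCurves hh
  have hsum : IsUpperGradient μ h (fun x => max (k x) c + min (k x) c) g := by
    simpa only [max_add_min] using H.add_const c
  refine hsum.of_add hh (hB.max_const hh c) (hB.min_const hh c) ?_
  filter_upwards [H.nonneg] with x hx
  exact (add_comm _ _).trans_le (indicator_lt_add_indicator_gt_le c hx)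

theorem IsSmallestBound.min_const (hh : IsWeakGauge h) (H : IsSmallestBound μ h k g) (c : ℝ) :
    IsSmallestBound μ h (fun x => min (k x) c) ({x | k x < c}.indicator g) := by
  refine ⟨H.bounds.min_const hh c, fun u hu => ?_⟩
  filter_upwards [H.le _ (hu.of_min_of_max hh (H.bounds.max_const hh c)), hu.nonneg] with x hx hx0
  rcases lt_or_ge (k x) c with hlt | hge
  · simpa [indicator, hlt, hlt.not_gt] using hx
  · simpa [indicator, hge.not_gt] using hx0

theorem IsSmallestBound.max_const (hh : IsWeakGauge h) (H : IsSmallestBound μ h k g) (c : ℝ) :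
    IsSmallestBound μ h (fun x => max (k x) c) ({x | c < k x}.indicator g) := by
  simpa only [min_neg_neg, neg_neg, neg_lt_neg_iff] using (H.neg.min_const hh (-c)).neg

end Truncation

end MeasureCurves

theorem mainTheorem4_general {X : Type*} [MetricSpace X] [LocallyCompactSpace X]
    [TopologicalSpace.SeparableSpace X] [MeasurableSpace X] [BorelSpace X]
    (μ : Measure X) [IsLocallyFiniteMeasure μ] (h : ℝ → ℝ) (hh : MeasureCurves.IsWeakGauge h)
    (k g : X → ℝ) (c : ℝ) :
    (MeasureCurves.IsUpperGradient μ h k g →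
      (∀ w : X → ℝ, MeasureCurves.IsUpperGradient μ h (fun x => min (k x) c) w ↔
        w =ᵐ[μ] {x | k x < c}.indicator g) ∧
      (∀ w : X → ℝ, MeasureCurves.IsUpperGradient μ h (fun x => max (k x) c) w ↔
        w =ᵐ[μ] {x | c < k x}.indicator g)) ∧
    (MeasureCurves.IsSmallestBound μ h k g →
      (∀ w : X → ℝ, MeasureCurves.IsSmallestBound μ h (fun x => min (k x) c) w ↔
        w =ᵐ[μ] {x | k x < c}.indicator g) ∧
      (∀ w : X → ℝ, MeasureCurves.IsSmallestBound μ h (fun x => max (k x) c) w ↔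
        w =ᵐ[μ] {x | c < k x}.indicator g)) := by
  have : SecondCountableTopology X := UniformSpace.secondCountable_of_separable X
  have : PolishSpace X := MeasureCurves.polishSpace_of_locallyCompact X
  exact ⟨fun H => ⟨fun _ => MeasureCurves.isUpperGradient_iff_ae_eq (H.min_const hh c),
      fun _ => MeasureCurves.isUpperGradient_iff_ae_eq (H.max_const hh c)⟩,
    fun H => ⟨fun _ => MeasureCurves.isSmallestBound_iff_ae_eq (H.min_const hh c),
      fun _ => MeasureCurves.isSmallestBound_iff_ae_eq (H.max_const hh c)⟩⟩

theorem mainTheorem4 {X : Type*} [MetricSpace X] [LocallyCompactSpace X]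
    [TopologicalSpace.SeparableSpace X] [MeasurableSpace X] [BorelSpace X]
    (μ : Measure X)
    (hμ : ∀ (x : X) (r : ℝ), 0 < r → 0 < μ (Metric.ball x r) ∧ μ (Metric.ball x r) < ∞)
    (h : ℝ → ℝ) (hh : MeasureCurves.IsGauge h) (k g : X → ℝ) (c : ℝ) :
    (MeasureCurves.IsUpperGradient μ h k g →
      (∀ w : X → ℝ, MeasureCurves.IsUpperGradient μ h (fun x => min (k x) c) w ↔
        w =ᵐ[μ] {x | k x < c}.indicator g) ∧
      (∀ w : X → ℝ, MeasureCurves.IsUpperGradient μ h (fun x => max (k x) c) w ↔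
        w =ᵐ[μ] {x | c < k x}.indicator g)) ∧
    (MeasureCurves.IsSmallestBound μ h k g →
      (∀ w : X → ℝ, MeasureCurves.IsSmallestBound μ h (fun x => min (k x) c) w ↔
        w =ᵐ[μ] {x | k x < c}.indicator g) ∧
      (∀ w : X → ℝ, MeasureCurves.IsSmallestBound μ h (fun x => max (k x) c) w ↔
        w =ᵐ[μ] {x | c < k x}.indicator g)) := by
  have : IsLocallyFiniteMeasure μ :=
    ⟨fun x => ⟨Metric.ball x 1, Metric.ball_mem_nhds x one_pos, (hμ x 1 one_pos).2⟩⟩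
  exact mainTheorem4_general μ h hh.isWeakGauge k g c
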